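/- **Setting.** Let $T>0$, $n,m\ge 0$ integers, and let $A:[0,T]\times\mathbb R^n\to\mathbb R^n$, $B:[0,T]\times\mathbb R^n\to\mathbb R^{n\times m}$, $Q:[0,T]\times\mathbb R^n\to\mathbb R$, $S:[0,T]\times\mathbb R^n\to\mathbb R^m$, $R:[0,T]\times\mathbb R^n\to\mathbb S^m$ (symmetric matrices), $G:\mathbb R^n\to\mathbb R$. Here $|\cdot|$ is the Euclidean norm of vectors and the operator norm of matrices, $M\ge N$ between symmetric matrices (or self-adjoint operators) means that $M-N$ is positive semidefinite, and $\mathbb S^n_+$ is the set of symmetric positive semidefinite matrices. Assume: (H1) $A,B$ are continuous and there are constants $L_A,L_B,\tilde L_B>0$ such that for all $t\in[0,T]$, $x,\bar x\in\mathbb R^n$, $u\in\mathbb R^m$: $|A(t,x)-A(t,\bar x)|\le L_A|x-\bar x|$, $|B(t,x)-B(t,\bar x)|\le\tilde L_B|x-\bar x|$, $\langle[B(t,x)-B(t,\bar x)]^T(x-\bar x),u\rangle\le L_B|x-\bar x|^2$. (H2) $Q,S,R,G$ are continuous and there are constants $L,Q_0,G_0,S_0>0$, $\varepsilon_0\in(0,1)$,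 $\rho_0>0$ and a continuous $\rho:\mathbb R^n\to[\rho_0,\infty)$ such that for all $(t,x)\in[0,T]\times\mathbb R^n$: $R(t,x)\ge\rho(x)I$; $(1-\varepsilon_0)Q(t,x)-\frac12S(t,x)^TR(t,x)^{-1}S(t,x)\ge-L$; $G(x)\ge-L$; $Q(t,x)\le Q_0(1+|x|^2)$; $G(x)\le G_0(1+|x|^2)$; $|S(t,x)|\le S_0(1+|x|)$; $|A(t,x)+B(t,x)R(t,x)^{-1}S(t,x)|\le L(1+|x|)$; $|B(t,x)R(t,x)^{-1}B(t,x)^T|\le L$. (H3) $A,B,Q,S,R,G$ are twice continuously differentiable. For $(t,x)\in[0,T]\times\mathbb R^n$ and $u\in\mathcal U[t,T]=L^2(t,T;\mathbb R^m)$ let $$J(t,x;u)=\int_t^T\Big[Q(s,X(s))+\langle S(s,X(s)),u(s)\rangle+\tfrac12\langle R(s,X(s))u(s),u(s)\rangle\Big]ds+G(X(T)),$$ where $X$ is the solution of $\dot X=A(s,X)+B(s,X)u$ on $[t,T]$, $X(t)=x$. Let $D_uJ(t,x;u)\in L^2(t,T;\mathbb R^m)$ be the gradient of $J(t,x;\cdot)$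 at $u$, and $D_{uu}J(t,x;u)$, a bounded operator on $L^2(t,T;\mathbb R^m)$, the derivative of $D_uJ(t,x;\cdot)$ at $u$ (both in the sense of Fréchet). Fix $(t,x)\in[0,T]\times\mathbb R^n$ and $u\in\mathcal U[t,T]$, and let $X$ be as above. Let $Y$ solve, on $[t,T]$, $$\dot Y=-\mathbf A(s)^TY-Q_x(s,X)^T-S_x(s,X)^Tu-\tfrac12\sum_{j,k=1}^mu^ju^kR^{jk}_x(s,X)^T,\qquad Y(T)=G_x(X(T))^T.$$ With $B^j$ and $R^j$ the $j$-th columns of $B$ and $R$, and $\tilde B^i$ the $i$-th column of $B^T$, all coefficients being evaluated at $(s,X(s))$ and $u,Y$ at $s$, put $$\begin{aligned}\mathbf A(s)&=A_x+\sum_ju^jB^j_x,\\ \mathbf A_1(s)&=\sum_iY^iA^i_{xx}+Q_{xx}+\tfrac12\sum_{j,k}u^ju^kR^{jk}_{xx}+\sum_ju^j\Big[\sum_iY^iB^{ij}_{xx}+S^j_{xx}\Big],\\ \mathbf C(s)&=\sum_ju^jR^j_x+S_x+\sum_iY^i\tilde B^i_x.\end{aligned}$$ Let $\Phi=\Phi_{\mathbf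 A}$ be the fundamental matrix of $\mathbf A$: $\frac{d}{ds}\Phi(s,\tau)=\mathbf A(s)\Phi(s,\tau)$ for $s\in[\tau,T]$, $\Phi(\tau,\tau)=I$, for $\tau\in[t,T]$. (All differential equations are understood in integrated form, with continuous solutions.) **Proposition 5.2.** (a) $J(t,x;\cdot)$ is Fréchet differentiable on $L^2(t,T;\mathbb R^m)$ and $D_uJ(t,x;\cdot)$ is Fréchet differentiable at $u$. For every $v\in L^2(t,T;\mathbb R^m)$, with $X_1(s)=\int_t^s\Phi(s,r)B(r,X(r))v(r)\,dr$, all integrals below converge and $$\begin{aligned}\int_t^T\langle[D_{uu}J(t,x;u)v](s),v(s)\rangle ds={}&\int_t^T\langle R(s,X(s))v(s),v(s)\rangle ds+\langle G_{xx}(X(T))X_1(T),X_1(T)\rangle\\&+\int_t^T\langle\mathbf A_1(s)X_1(s),X_1(s)\rangle ds+2\int_t^T\langle\mathbf C(s)X_1(s),v(s)\rangle ds.\end{aligned}$$ (b) Suppose that $\bar G\in\mathbb S^n_+$, $\bar Q:[0,T]\to\mathbb S^n_+$, $\alpha\in(0,1)$ and $\delta>0$ satisfy $G_{xx}(X(T))+\bar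 G\ge0$, $$\mathbf A_1(s)+\bar Q(s)-\alpha^{-1}\mathbf C(s)^TR(s,X(s))^{-1}\mathbf C(s)\ge0\quad\text{for a.e. }s\in[t,T],$$ and $$(1-\alpha)R(s,X(s))-[\hat G(t)+\hat Q(s,t)]I\ge\delta I\quad\text{for all }s\in[t,T],$$ where $$\begin{aligned}\hat G(t)&=\Big[\int_t^T\!\!\int_t^T|B(s,X(s))^T\Phi(T,s)^T\bar G\,\Phi(T,r)B(r,X(r))|^2drds\Big]^{1/2},\\ \hat Q(s,t)&=\int_s^T\Big[\int_t^\tau\!\!\int_t^\tau|B(r,X(r))^T\Phi(\tau,r)^T\bar Q(\tau)\Phi(\tau,r')B(r',X(r'))|^2dr'dr\Big]^{1/2}d\tau,\end{aligned}$$ and the function of $\tau$ integrated in $\hat Q(t,t)$ is assumed Lebesgue integrable on $[t,T]$. Then $D_{uu}J(t,x;u)\ge\delta I$. -/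

import Mathlib

open MeasureTheory Set
open scoped InnerProductSpace

noncomputable section

/-- `ℝᵏ` with its Euclidean norm. -/
abbrev RVec (k : ℕ) : Type := EuclideanSpace ℝ (Fin k)

/-- Matrices `ℝ^{k × l}`, regarded as linear maps `ℝˡ → ℝᵏ`. The norm is the operator norm, the
transpose is the adjoint `ContinuousLinearMap.adjoint`, `≤` is the Loewner order (`M ≤ N` means that
`N - M` is symmetric and positive semidefinite), and `1` is the identity matrix. -/
abbrev RMat (k l : ℕ) : Type := RVec l →L[ℝ] RVec k

/-- The control space `𝒰[t, T] = L²(t, T; ℝᵐ)` (all controls, that is, `U = ℝᵐ`). -/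
abbrev ControlSpace (m : ℕ) (t T : ℝ) : Type :=
  Lp (RVec m) 2 ((volume : Measure ℝ).restrict (Ioc t T))

/-- The Hessian matrix `f_xx(x)` of a scalar function, as the derivative of its gradient. -/
def hessian {n : ℕ} (f : RVec n → ℝ) (x : RVec n) : RMat n n :=
  fderiv ℝ (fun z => gradient f z) x

/-- The data of an affine-quadratic control problem: the horizon `T` and the coefficients of the
state equation `Ẋ = A(s, X) + B(s, X) u` and of the cost
`∫ [Q(s, X) + ⟨S(s, X), u⟩ + ½ ⟨R(s, X) u, u⟩] ds + G(X(T))`. Only times in `[0, T]` matter. -/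
structure AQProblem (n m : ℕ) where
  T : ℝ
  A : ℝ → RVec n → RVec n
  B : ℝ → RVec n → RMat n m
  Q : ℝ → RVec n → ℝ
  S : ℝ → RVec n → RVec m
  R : ℝ → RVec n → RMat m m
  G : RVec n → ℝ

namespace AQProblem

variable {n m : ℕ} (P : AQProblem n m)

/-- The domain `[0, T] × ℝⁿ` of the coefficients. -/
def domain : Set (ℝ × RVec n) := Icc 0 P.T ×ˢ univ

/-- Hypothesis (H1) on the state equation, for `U = ℝᵐ`. -/
structure H1 : Prop where
  continuous_A : ContinuousOn (fun p : ℝ × RVec n => P.A p.1 p.2) P.domain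
  continuous_B : ContinuousOn (fun p : ℝ × RVec n => P.B p.1 p.2) P.domain
  lipschitz_A : ∃ LA > (0 : ℝ), ∀ t ∈ Icc 0 P.T, ∀ x y : RVec n,
    ‖P.A t x - P.A t y‖ ≤ LA * ‖x - y‖
  lipschitz_B : ∃ LB' > (0 : ℝ), ∀ t ∈ Icc 0 P.T, ∀ x y : RVec n,
    ‖P.B t x - P.B t y‖ ≤ LB' * ‖x - y‖
  one_sided_B : ∃ LB > (0 : ℝ), ∀ t ∈ Icc 0 P.T, ∀ (u : RVec m) (x y : RVec n),
    ⟪(P.B t x - P.B t y).adjoint (x - y), u⟫_ℝ ≤ LB * ‖x - y‖ ^ 2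

/-- Hypothesis (H2) on the cost. -/
structure H2 : Prop where
  continuous_Q : ContinuousOn (fun p : ℝ × RVec n => P.Q p.1 p.2) P.domain
  continuous_S : ContinuousOn (fun p : ℝ × RVec n => P.S p.1 p.2) P.domain
  continuous_R : ContinuousOn (fun p : ℝ × RVec n => P.R p.1 p.2) P.domain
  continuous_G : Continuous P.G
  symmetric_R : ∀ t ∈ Icc 0 P.T, ∀ x : RVec n, (P.R t x).adjoint = P.R t x
  bounds : ∃ L > (0 : ℝ), ∃ Q₀ > (0 : ℝ), ∃ G₀ > (0 : ℝ), ∃ S₀ > (0 : ℝ),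
    ∃ ε₀ ∈ Ioo (0 : ℝ) 1, ∃ ρ₀ > (0 : ℝ), ∃ ρ : RVec n → ℝ,
      Continuous ρ ∧ (∀ x, ρ₀ ≤ ρ x) ∧ (∀ x, -L ≤ P.G x ∧ P.G x ≤ G₀ * (1 + ‖x‖ ^ 2)) ∧
      ∀ t ∈ Icc 0 P.T, ∀ x : RVec n,
        ρ x • (1 : RMat m m) ≤ P.R t x ∧
        -L ≤ (1 - ε₀) * P.Q t x - 1 / 2 * ⟪P.S t x, (P.R t x).inverse (P.S t x)⟫_ℝ ∧
        P.Q t x ≤ Q₀ * (1 + ‖x‖ ^ 2) ∧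
        ‖P.S t x‖ ≤ S₀ * (1 + ‖x‖) ∧
        ‖P.A t x + P.B t x ((P.R t x).inverse (P.S t x))‖ ≤ L * (1 + ‖x‖) ∧
        ‖P.B t x ∘L (P.R t x).inverse ∘L (P.B t x).adjoint‖ ≤ L

/-- Hypothesis (H3): the coefficients are twice continuously differentiable. -/
structure H3 : Prop where
  smooth_A : ContDiffOn ℝ 2 (fun p : ℝ × RVec n => P.A p.1 p.2) P.domain
  smooth_B : ContDiffOn ℝ 2 (fun p : ℝ × RVec n => P.B p.1 p.2) P.domain
  smooth_Q : ContDiffOn ℝ 2 (fun p : ℝ × RVec n => P.Q p.1 p.2) P.domain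
  smooth_S : ContDiffOn ℝ 2 (fun p : ℝ × RVec n => P.S p.1 p.2) P.domain
  smooth_R : ContDiffOn ℝ 2 (fun p : ℝ × RVec n => P.R p.1 p.2) P.domain
  smooth_G : ContDiff ℝ 2 P.G

/-- `X` solves `Ẋ(s) = A(s, X(s)) + B(s, X(s)) u(s)` on `[t, T]`, `X(t) = x` (in the sense of
Carathéodory, that is, in integrated form). -/
def IsState (t : ℝ) (x : RVec n) (u : ControlSpace m t P.T) (X : ℝ → RVec n) : Prop :=
  ContinuousOn X (Icc t P.T) ∧
    ∀ s ∈ Icc t P.T, X s = x + ∫ r in t..s, (P.A r (X r) + P.B r (X r) (u r))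

open Classical in
/-- The state trajectory `X(·; t, x, u)`: the solution of the state equation on `[t, T]`, which
exists and is unique on `[t, T]` when the coefficients are Lipschitz (the value in the other case is
irrelevant). -/
def state (t : ℝ) (x : RVec n) (u : ControlSpace m t P.T) : ℝ → RVec n :=
  if h : ∃ X, P.IsState t x u X then h.choose else fun _ => x

/-- The cost functional `J(t, x; u)`. -/
def J (t : ℝ) (x : RVec n) (u : ControlSpace m t P.T) : ℝ :=
  (∫ s in t..P.T, (P.Q s (P.state t x u s) + ⟪P.S s (P.state t x u s), u s⟫_ℝ
      + 1 / 2 * ⟪P.R s (P.state t x u s) (u s), u s⟫_ℝ))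
    + P.G (P.state t x u P.T)

/-- The first derivative `D_u J(t, x; u) ∈ L²(t, T; ℝᵐ)` (through the Riesz isomorphism). -/
def DuJ (t : ℝ) (x : RVec n) (u : ControlSpace m t P.T) : ControlSpace m t P.T :=
  gradient (P.J t x) u

/-- The second derivative `D_uu J(t, x; u)`, a bounded operator on `L²(t, T; ℝᵐ)`: the Fréchet
derivative of `u ↦ D_u J(t, x; u)`. -/
def DuuJ (t : ℝ) (x : RVec n) (u : ControlSpace m t P.T) :
    ControlSpace m t P.T →L[ℝ] ControlSpace m t P.T :=
  fderiv ℝ (P.DuJ t x) u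

/-- `𝐀 = A_x(s, x) + ∑ⱼ uʲ B_xʲ(s, x)`, where `Bʲ` is the `j`-th column of `B`. -/
def bA (s : ℝ) (x : RVec n) (u : RVec m) : RMat n n :=
  fderiv ℝ (P.A s) x + fderiv ℝ (fun z => P.B s z u) x

/-- `𝐀₁ = ∑ᵢ yⁱ Aⁱ_xx + Q_xx + ½ ∑ⱼₖ uʲ uᵏ Rʲᵏ_xx + ∑ⱼ uʲ (∑ᵢ yⁱ Bⁱʲ_xx + Sʲ_xx)` at `(s, x)`;
here `y` and `u` are constant vectors, so each sum is the Hessian of the contracted function. -/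
def bA₁ (s : ℝ) (x y : RVec n) (u : RVec m) : RMat n n :=
  hessian (fun z => ⟪y, P.A s z⟫_ℝ) x
    + hessian (P.Q s) x
    + (1 / 2 : ℝ) • hessian (fun z => ⟪P.R s z u, u⟫_ℝ) x
    + (hessian (fun z => ⟪y, P.B s z u⟫_ℝ) x + hessian (fun z => ⟪P.S s z, u⟫_ℝ) x)

/-- `𝐂 = ∑ⱼ uʲ Rʲ_x(s, x) + S_x(s, x) + ∑ᵢ yⁱ B̃ⁱ_x(s, x)`, where `Rʲ` is the `j`-th column of `R`
and `B̃ⁱ` is the `i`-th column of the transpose of `B`. -/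
def bC (s : ℝ) (x y : RVec n) (u : RVec m) : RMat m n :=
  fderiv ℝ (fun z => P.R s z u) x + fderiv ℝ (P.S s) x
    + fderiv ℝ (fun z => (P.B s z).adjoint y) x

/-- `Y` solves the adjoint equation
`Ẏ(s) = -𝐀(s)ᵀ Y(s) - Q_x(s, X)ᵀ - S_x(s, X)ᵀ u(s) - ½ ∑ⱼₖ uʲ(s) uᵏ(s) Rʲᵏ_x(s, X)ᵀ` on `[t, T]`,
`Y(T) = G_x(X(T))ᵀ`, in integrated form. -/
def IsAdjointState (t : ℝ) (u : ControlSpace m t P.T) (X Y : ℝ → RVec n) : Prop :=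
  ContinuousOn Y (Icc t P.T) ∧
    ∀ s ∈ Icc t P.T, Y s = gradient P.G (X P.T) +
      ∫ r in s..P.T, ((P.bA r (X r) (u r)).adjoint (Y r) + gradient (P.Q r) (X r)
        + (fderiv ℝ (P.S r) (X r)).adjoint (u r)
        + (1 / 2 : ℝ) • gradient (fun z => ⟪P.R r z (u r), u r⟫_ℝ) (X r))

/-- `Φ(s, τ)`, `t ≤ τ ≤ s ≤ T`, is the fundamental matrix of the matrix function `M` on `[t, T]`:
`d/ds Φ(s, τ) = M(s) Φ(s, τ)`, `Φ(τ, τ) = I`, in integrated form. -/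
def IsFundamentalMatrix (t : ℝ) (M : ℝ → RMat n n) (Φ : ℝ → ℝ → RMat n n) : Prop :=
  ∀ τ ∈ Icc t P.T, ContinuousOn (fun s => Φ s τ) (Icc τ P.T) ∧
    ∀ s ∈ Icc τ P.T, Φ s τ = 1 + ∫ r in τ..s, M r ∘L Φ r τ

/-- `∫_t^s Φ(s, r) B(r, X(r)) v(r) dr`. -/
def linResponse (t : ℝ) (X : ℝ → RVec n) (Φ : ℝ → ℝ → RMat n n)
    (v : ControlSpace m t P.T) (s : ℝ) : RVec n :=
  ∫ r in t..s, Φ s r (P.B r (X r) (v r))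

/-- The kernel `B(r, X(r))ᵀ Φ(τ, r)ᵀ M Φ(τ, r') B(r', X(r'))`. -/
def kernel (X : ℝ → RVec n) (Φ : ℝ → ℝ → RMat n n) (M : RMat n n) (τ r r' : ℝ) : RMat m m :=
  (P.B r (X r)).adjoint ∘L (Φ τ r).adjoint ∘L M ∘L Φ τ r' ∘L P.B r' (X r')

/-- `[∫_t^τ ∫_t^τ |B(r, X(r))ᵀ Φ(τ, r)ᵀ M Φ(τ, r') B(r', X(r'))|² dr' dr]^{1/2}`. -/
def kernelNorm (t : ℝ) (X : ℝ → RVec n) (Φ : ℝ → ℝ → RMat n n) (M : RMat n n) (τ : ℝ) : ℝ :=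
  Real.sqrt (∫ r in t..τ, ∫ r' in t..τ, ‖P.kernel X Φ M τ r r'‖ ^ 2)

/-- `Ĝ(t)`. -/
def GHat (t : ℝ) (X : ℝ → RVec n) (Φ : ℝ → ℝ → RMat n n) (Gbar : RMat n n) : ℝ :=
  P.kernelNorm t X Φ Gbar P.T

/-- `Q̂(s, t)`. -/
def QHat (t : ℝ) (X : ℝ → RVec n) (Φ : ℝ → ℝ → RMat n n) (Qbar : ℝ → RMat n n) (s : ℝ) : ℝ :=
  ∫ τ in s..P.T, P.kernelNorm t X Φ (Qbar τ) τ

end AQProblem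

end

/-!
Since `A` and `B` are Lipschitz in the state and twice continuously differentiable, the state
equation is a fixed-point equation for a `C²` map whose partial derivative in the state is a
Volterra operator plus the identity. The implicit function theorem makes the control-to-state map
`C²`, hence `J(t, x; ·)` as well. Along `u + εv` the state has the expansion
`X + ε X₁ + ½ ε² X₂`, and the second derivative of `J` in direction `v` is read off from the second
order term. There `X₂` occurs linearly; the product rule for `⟨Y, X₂⟩` and the adjoint equation
replace it by terms quadratic in `X₁` and `v`, which is where `𝐀₁` and `𝐂` come from. Variation of
constants gives `X₁ = ∫ Φ B v`.

For positivity, completing the square in `v` bounds the integrand below by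
`(1 - α) ⟨R v, v⟩ - ⟨Q̄ X₁, X₁⟩`. By the Cauchy–Schwarz inequality for the kernel of the integral
operator `v ↦ X₁`, `⟨M X₁(τ), X₁(τ)⟩` is at most the Hilbert–Schmidt norm of the kernel of `M` at
time `τ` times `∫ₜ^τ |v|²`, and integration by parts turns the bound for `Q̄` into
`∫ Q̂(s, t) |v(s)|² ds`.
-/

noncomputable section

open Filter Topology
open scoped ENNReal NNReal

section Superposition

/-- The superposition operator `X ↦ (s ↦ g (s, X s))` on continuous functions. -/
def superpose {K E V : Type*} [TopologicalSpace K] [TopologicalSpace E] [TopologicalSpace V]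
    (g : C(K × E, V)) (X : C(K, E)) : C(K, V) :=
  g.comp ((ContinuousMap.id K).prodMk X)

theorem continuous_superpose {K E V : Type*} [TopologicalSpace K] [LocallyCompactSpace K]
    [TopologicalSpace E] [TopologicalSpace V] (g : C(K × E, V)) : Continuous (superpose g) :=
  ContinuousMap.continuous_of_continuous_uncurry _ <|
    show Continuous fun p : C(K, E) × K => g (p.2, p.1 p.2) by fun_prop

theorem exists_uniform_modulus {K E V : Type*} [TopologicalSpace K] [CompactSpace K]
    [LocallyCompactSpace K] [SeminormedAddCommGroup E] [SeminormedAddCommGroup V]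
    (g : C(K × E, V)) (X : C(K, E)) {c : ℝ} (hc : 0 < c) :
    ∃ δ > 0, ∀ s z, ‖z - X s‖ < δ → ‖g (s, z) - g (s, X s)‖ < c := by
  obtain ⟨δ, hδ, hclose⟩ := Metric.continuousAt_iff.1 (continuous_superpose g).continuousAt c hc
  refine ⟨δ, hδ, fun s z hz => ?_⟩
  -- test the continuity of `superpose g` at `X` on the translate of `X` through `(s, z)`
  have htranslate : dist (X + ContinuousMap.const K (z - X s)) X < δ := by
    rw [dist_eq_norm, add_sub_cancel_left]
    exact ((ContinuousMap.norm_le _ (norm_nonneg (z - X s))).2 fun _ => le_rfl).trans_lt hz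
  have hnorm := hclose htranslate
  rw [dist_eq_norm] at hnorm
  simpa [superpose] using (ContinuousMap.norm_coe_le_norm _ s).trans_lt hnorm

variable {K E V : Type*} [TopologicalSpace K] [CompactSpace K]
  [NormedAddCommGroup E] [NormedSpace ℝ E] [NormedAddCommGroup V] [NormedSpace ℝ V]

/-- Pointwise application of operator-valued continuous functions, as a bounded bilinear map. -/
def pointwiseApply : C(K, E →L[ℝ] V) →L[ℝ] C(K, E) →L[ℝ] C(K, V) :=
  LinearMap.mkContinuous₂
    (LinearMap.mk₂ ℝ (fun (a : C(K, E →L[ℝ] V)) (h : C(K, E)) =>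
        (⟨fun s => a s (h s), by fun_prop⟩ : C(K, V)))
      (fun _ _ _ => by ext; simp) (fun _ _ _ => by ext; simp)
      (fun _ _ _ => by ext; simp) (fun _ _ _ => by ext; simp)) 1
    (fun a h => (ContinuousMap.norm_le _ (by positivity)).2 fun s => by
      rw [one_mul]
      exact (a s).le_of_opNorm_le_of_le (a.norm_coe_le_norm s) (h.norm_coe_le_norm s))

/-- A coefficient `f₀ : K × E → V`, twice differentiable in the second variable, with jointly
continuous derivatives `f₁` and `f₂`. -/
structure C2Coeff (K E V : Type*) [TopologicalSpace K] [NormedAddCommGroup E] [NormedSpace ℝ E]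
    [NormedAddCommGroup V] [NormedSpace ℝ V] where
  f₀ : C(K × E, V)
  f₁ : C(K × E, E →L[ℝ] V)
  f₂ : C(K × E, E →L[ℝ] E →L[ℝ] V)
  hasFDerivAt₀ : ∀ s x, HasFDerivAt (fun z => f₀ (s, z)) (f₁ (s, x)) x
  hasFDerivAt₁ : ∀ s x, HasFDerivAt (fun z => f₁ (s, z)) (f₂ (s, x)) x

namespace C2Coeff

/-- The first derivative of `ε ↦ g (s, X_ε s)` at `0`, for a curve `X_ε` of functions with
`X₀ = X` and first derivative `h`. -/
def jet₁ (g : C2Coeff K E V) (X h : C(K, E)) : C(K, V) :=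
  pointwiseApply (superpose g.f₁ X) h

/-- The second derivative of `ε ↦ g (s, X_ε s)` at `0`, for a curve `X_ε` of functions with
`X₀ = X`, first derivative `h` and second derivative `k`. -/
def jet₂ (g : C2Coeff K E V) (X h k : C(K, E)) : C(K, V) :=
  pointwiseApply (pointwiseApply (superpose g.f₂ X) h) h + pointwiseApply (superpose g.f₁ X) k

end C2Coeff

variable [LocallyCompactSpace K]

theorem hasFDerivAt_superpose (g : C(K × E, V)) (g' : C(K × E, E →L[ℝ] V))
    (hg : ∀ s x, HasFDerivAt (fun z => g (s, z)) (g' (s, x)) x) (X : C(K, E)) :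
    HasFDerivAt (superpose g) (pointwiseApply (superpose g' X)) X := by
  rw [hasFDerivAt_iff_isLittleO_nhds_zero, Asymptotics.isLittleO_iff]
  intro c hc
  obtain ⟨δ, hδ, hclose⟩ := exists_uniform_modulus g' X hc
  filter_upwards [Metric.ball_mem_nhds (0 : C(K, E)) hδ] with h hh
  rw [mem_ball_zero_iff] at hh
  refine (ContinuousMap.norm_le _ (by positivity)).2 fun s => ?_
  have hderiv : ∀ z ∈ Metric.ball (X s) δ, ‖g' (s, z) - g' (s, X s)‖ ≤ c := fun z hz =>
    (hclose s z (by rwa [Metric.mem_ball, dist_eq_norm] at hz)).le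
  have hmem : X s + h s ∈ Metric.ball (X s) δ := by
    rw [Metric.mem_ball, dist_eq_norm, add_sub_cancel_left]
    exact (h.norm_coe_le_norm s).trans_lt hh
  calc ‖g (s, X s + h s) - g (s, X s) - g' (s, X s) (h s)‖ ≤ c * ‖h s‖ := by
        simpa only [add_sub_cancel_left] using
          (convex_ball (X s) δ).norm_image_sub_le_of_norm_hasFDerivWithin_le'
            (fun z _ => (hg s z).hasFDerivWithinAt) hderiv (Metric.mem_ball_self hδ) hmem
    _ ≤ c * ‖h‖ := by gcongr; exact h.norm_coe_le_norm s

namespace C2Coeff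

theorem hasFDerivAt_pointwiseApply_superpose (g : C2Coeff K E V) (X : C(K, E)) :
    HasFDerivAt (fun X => (pointwiseApply (superpose g.f₁ X) : C(K, E) →L[ℝ] C(K, V)))
      (pointwiseApply.comp (pointwiseApply (superpose g.f₂ X))) X :=
  (pointwiseApply : C(K, E →L[ℝ] V) →L[ℝ] C(K, E) →L[ℝ] C(K, V)).hasFDerivAt.comp X
    (hasFDerivAt_superpose g.f₁ g.f₂ g.hasFDerivAt₁ X)

theorem contDiff_superpose (g : C2Coeff K E V) : ContDiff ℝ 2 (superpose g.f₀) := by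
  have hderiv : ContDiff ℝ 1 fun X =>
      (pointwiseApply (superpose g.f₁ X) : C(K, E) →L[ℝ] C(K, V)) :=
    contDiff_one_iff_hasFDerivAt.2 ⟨_, continuous_const.clm_comp
      (pointwiseApply.continuous.comp (continuous_superpose g.f₂)),
      g.hasFDerivAt_pointwiseApply_superpose⟩
  have h := contDiff_succ_iff_hasFDerivAt.2
    ⟨_, hderiv, hasFDerivAt_superpose g.f₀ g.f₁ g.hasFDerivAt₀⟩
  norm_num at h
  exact h

end C2Coeff

end Superposition

section Jets

variable {E F V : Type*} [NormedAddCommGroup E] [NormedSpace ℝ E] [NormedAddCommGroup F]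
  [NormedSpace ℝ F] [NormedAddCommGroup V] [NormedSpace ℝ V]

/-- The curve `c` is differentiable, and at time `0` it has first derivative `c₁` and second
derivative `c₂`. -/
def HasJet2 (c : ℝ → E) (c₁ c₂ : E) : Prop :=
  ∃ c' : ℝ → E, (∀ ε, HasDerivAt c (c' ε) ε) ∧ c' 0 = c₁ ∧ HasDerivAt c' c₂ 0

namespace HasJet2

theorem unique {c : ℝ → E} {c₁ c₂ d₁ d₂ : E} (h : HasJet2 c c₁ c₂) (k : HasJet2 c d₁ d₂) :
    c₁ = d₁ ∧ c₂ = d₂ := by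
  obtain ⟨c', hc, rfl, hc'⟩ := h
  obtain ⟨d', hd, rfl, hd'⟩ := k
  obtain rfl : c' = d' := funext fun ε => (hc ε).unique (hd ε)
  exact ⟨rfl, hc'.unique hd'⟩

theorem const (x : E) : HasJet2 (fun _ => x) 0 0 :=
  ⟨fun _ => 0, fun ε => hasDerivAt_const ε x, rfl, hasDerivAt_const 0 0⟩

theorem line (u v : E) : HasJet2 (fun ε : ℝ => u + ε • v) v 0 :=
  ⟨fun _ => v, fun ε => by simpa using ((hasDerivAt_id ε).smul_const v).const_add u, rfl,
    hasDerivAt_const 0 v⟩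

theorem add {c d : ℝ → E} {c₁ c₂ d₁ d₂ : E} (h : HasJet2 c c₁ c₂) (k : HasJet2 d d₁ d₂) :
    HasJet2 (fun ε => c ε + d ε) (c₁ + d₁) (c₂ + d₂) := by
  obtain ⟨c', hc, rfl, hc'⟩ := h
  obtain ⟨d', hd, rfl, hd'⟩ := k
  exact ⟨fun ε => c' ε + d' ε, fun ε => (hc ε).add (hd ε), rfl, hc'.add hd'⟩

theorem clm_apply (L : E →L[ℝ] F) {c : ℝ → E} {c₁ c₂ : E} (h : HasJet2 c c₁ c₂) :
    HasJet2 (fun ε => L (c ε)) (L c₁) (L c₂) := by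
  obtain ⟨c', hc, rfl, hc'⟩ := h
  exact ⟨fun ε => L (c' ε), fun ε => L.hasFDerivAt.comp_hasDerivAt ε (hc ε), rfl,
    L.hasFDerivAt.comp_hasDerivAt 0 hc'⟩

theorem bilin (B : E →L[ℝ] F →L[ℝ] V) {c : ℝ → E} {c₁ c₂ : E} {d : ℝ → F} {d₁ d₂ : F}
    (h : HasJet2 c c₁ c₂) (k : HasJet2 d d₁ d₂) :
    HasJet2 (fun ε => B (c ε) (d ε)) (B c₁ (d 0) + B (c 0) d₁)
      (B c₂ (d 0) + (2 : ℝ) • B c₁ d₁ + B (c 0) d₂) := by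
  obtain ⟨c', hc, rfl, hc'⟩ := h
  obtain ⟨d', hd, rfl, hd'⟩ := k
  have product : ∀ {c : ℝ → E} {c' : E} {d : ℝ → F} {d' : F} {ε : ℝ}, HasDerivAt c c' ε →
      HasDerivAt d d' ε → HasDerivAt (fun ε => B (c ε) (d ε)) (B c' (d ε) + B (c ε) d') ε :=
    fun hc hd => (B.hasFDerivAt.comp_hasDerivAt _ hc).clm_apply hd
  refine ⟨_, fun ε => product (hc ε) (hd ε), rfl, ?_⟩
  refine ((product hc' (hd 0)).add (product (hc 0) hd')).congr_deriv ?_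
  rw [two_smul]
  abel

theorem comp {Ψ : E → F} {Ψ' : E → E →L[ℝ] F} {Ψ'' : E →L[ℝ] E →L[ℝ] F} {c : ℝ → E} {c₁ c₂ : E}
    (hΨ : ∀ x, HasFDerivAt Ψ (Ψ' x) x) (hΨ' : HasFDerivAt Ψ' Ψ'' (c 0)) (hc : HasJet2 c c₁ c₂) :
    HasJet2 (fun ε => Ψ (c ε)) (Ψ' (c 0) c₁) (Ψ'' c₁ c₁ + Ψ' (c 0) c₂) := by
  obtain ⟨c', hc, rfl, hc'⟩ := hc
  exact ⟨fun ε => Ψ' (c ε) (c' ε), fun ε => (hΨ (c ε)).comp_hasDerivAt ε (hc ε), rfl,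
    (hΨ'.comp_hasDerivAt 0 (hc 0)).clm_apply hc'⟩

theorem comp_contDiff {Ψ : E → F} (hΨ : ContDiff ℝ 2 Ψ) {c : ℝ → E} {c₁ c₂ : E}
    (hc : HasJet2 c c₁ c₂) :
    HasJet2 (fun ε => Ψ (c ε)) (fderiv ℝ Ψ (c 0) c₁)
      (fderiv ℝ (fderiv ℝ Ψ) (c 0) c₁ c₁ + fderiv ℝ Ψ (c 0) c₂) :=
  hc.comp (fun x => (hΨ.differentiable two_ne_zero x).hasFDerivAt)
    ((hΨ.fderiv_right (m := 1) (by norm_num)).differentiable one_ne_zero _).hasFDerivAt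

theorem superpose {K : Type*} [TopologicalSpace K] [CompactSpace K] [LocallyCompactSpace K]
    (g : C2Coeff K E V) {c : ℝ → C(K, E)} {c₁ c₂ : C(K, E)} (hc : HasJet2 c c₁ c₂) :
    HasJet2 (fun ε => _root_.superpose g.f₀ (c ε)) (g.jet₁ (c 0) c₁) (g.jet₂ (c 0) c₁ c₂) := by
  have h := comp (hasFDerivAt_superpose g.f₀ g.f₁ g.hasFDerivAt₀)
    (g.hasFDerivAt_pointwiseApply_superpose (c 0)) hc
  rw [ContinuousLinearMap.comp_apply] at h
  exact h

end HasJet2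

end Jets

section IntegralCalculus

variable {E F G : Type*} [NormedAddCommGroup E] [NormedAddCommGroup F] [NormedAddCommGroup G]
  {a b : ℝ}

theorem memLp_Ioc_of_continuousOn {f : ℝ → E} (hf : ContinuousOn f (Icc a b)) (p : ℝ≥0∞) :
    MemLp f p (volume.restrict (Ioc a b)) := by
  obtain ⟨C, hC⟩ := isCompact_Icc.exists_bound_of_continuousOn hf
  refine MemLp.of_bound ((hf.mono Ioc_subset_Icc_self).aestronglyMeasurable measurableSet_Ioc) C ?_
  filter_upwards [ae_restrict_mem measurableSet_Ioc] with r hr using hC r (Ioc_subset_Icc_self hr)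

variable [NormedSpace ℝ E] [NormedSpace ℝ F] [NormedSpace ℝ G]

theorem intervalIntegrable_bilin (B : E →L[ℝ] F →L[ℝ] G) (hab : a ≤ b) {f : ℝ → E} {g : ℝ → F}
    (hf : ContinuousOn f (Icc a b)) (hg : IntervalIntegrable g volume a b) :
    IntervalIntegrable (fun r => B (f r) (g r)) volume a b := by
  rw [intervalIntegrable_iff_integrableOn_Ioc_of_le hab, IntegrableOn, ← memLp_one_iff_integrable]
    at hg ⊢
  exact B.memLp_of_bilin (p := ∞) (q := 1) 1 (memLp_Ioc_of_continuousOn hf ∞) hg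

theorem intervalIntegrable_clm_apply (hab : a ≤ b) {L : ℝ → E →L[ℝ] F} {f : ℝ → E}
    (hL : ContinuousOn L (Icc a b)) (hf : IntervalIntegrable f volume a b) :
    IntervalIntegrable (fun r => L r (f r)) volume a b :=
  intervalIntegrable_bilin (ContinuousLinearMap.apply ℝ F).flip hab hL hf

theorem absolutelyContinuousOnInterval_of_dist_le {X Y : Type*} [PseudoMetricSpace X]
    [PseudoMetricSpace Y] {f : ℝ → X} {g : ℝ → Y} (K : ℝ)
    (hg : AbsolutelyContinuousOnInterval g a b)
    (hfg : ∀ x ∈ uIcc a b, ∀ y ∈ uIcc a b, dist (f x) (f y) ≤ K * dist (g x) (g y)) :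
    AbsolutelyContinuousOnInterval f a b := by
  have hKg := Filter.Tendsto.const_mul K hg
  rw [mul_zero] at hKg
  refine squeeze_zero' (.of_forall fun _ => Finset.sum_nonneg fun _ _ => dist_nonneg) ?_ hKg
  filter_upwards [mem_inf_of_right (mem_principal_self _)] with I hI
  rw [Finset.mul_sum]
  exact Finset.sum_le_sum fun i hi => hfg _ (hI.1 i hi).1 _ (hI.1 i hi).2

/-- On `[a, b]`, the function `f` is absolutely continuous with derivative `φ`, expressed as the
integral equation `f s = f a + ∫ r in a..s, φ r` with `φ` integrable. -/
structure IsPrimitiveOn (f φ : ℝ → E) (a b : ℝ) : Prop where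
  intervalIntegrable : IntervalIntegrable φ volume a b
  eq_add_integral : ∀ s ∈ Icc a b, f s = f a + ∫ r in a..s, φ r

namespace IsPrimitiveOn

variable {f φ : ℝ → E} {g γ : ℝ → F}

theorem of_eq_add_integral (hab : a ≤ b) {c : E} (hφ : IntervalIntegrable φ volume a b)
    (hf : ∀ s ∈ Icc a b, f s = c + ∫ r in a..s, φ r) : IsPrimitiveOn f φ a b := by
  refine ⟨hφ, fun s hs => ?_⟩
  rw [hf s hs, hf a (left_mem_Icc.2 hab), intervalIntegral.integral_same, add_zero]

theorem intervalIntegrable_of_mem (hf : IsPrimitiveOn f φ a b) {s τ : ℝ} (hs : s ∈ Icc a b)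
    (hτ : τ ∈ Icc a b) : IntervalIntegrable φ volume s τ :=
  hf.intervalIntegrable.mono_set
    (uIcc_subset_uIcc (Icc_subset_uIcc hs) (Icc_subset_uIcc hτ))

theorem sub_eq_integral (hf : IsPrimitiveOn f φ a b) {s τ : ℝ} (hs : s ∈ Icc a b)
    (hτ : τ ∈ Icc a b) : f s - f τ = ∫ r in τ..s, φ r := by
  have ha : a ∈ Icc a b := left_mem_Icc.2 (hs.1.trans hs.2)
  rw [hf.eq_add_integral s hs, hf.eq_add_integral τ hτ, add_sub_add_left_eq_sub,
    intervalIntegral.integral_interval_sub_left (hf.intervalIntegrable_of_mem ha hs)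
      (hf.intervalIntegrable_of_mem ha hτ)]

theorem mono (hf : IsPrimitiveOn f φ a b) {a' b' : ℝ} (h : Icc a' b' ⊆ Icc a b) (hab' : a' ≤ b') :
    IsPrimitiveOn f φ a' b' := by
  have ha' := h (left_mem_Icc.2 hab')
  refine ⟨hf.intervalIntegrable_of_mem ha' (h (right_mem_Icc.2 hab')), fun s hs => ?_⟩
  rw [← hf.sub_eq_integral (h hs) ha', add_sub_cancel]

theorem of_eq_add_integral_right (hab : a ≤ b) {c : E} (hφ : IntervalIntegrable φ volume a b)
    (hf : ∀ s ∈ Icc a b, f s = c + ∫ r in s..b, φ r) : IsPrimitiveOn f (fun r => -φ r) a b := by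
  refine ⟨hφ.neg, fun s hs => ?_⟩
  have hsub : ∀ {x y}, x ∈ Icc a b → y ∈ Icc a b → IntervalIntegrable φ volume x y :=
    fun hx hy => hφ.mono_set (uIcc_subset_uIcc (Icc_subset_uIcc hx) (Icc_subset_uIcc hy))
  rw [hf s hs, hf a (left_mem_Icc.2 hab), intervalIntegral.integral_neg, add_assoc,
    ← intervalIntegral.integral_add_adjacent_intervals (hsub (left_mem_Icc.2 hab) hs)
      (hsub hs (right_mem_Icc.2 hab))]
  abel

theorem continuousOn (hf : IsPrimitiveOn f φ a b) : ContinuousOn f (Icc a b) := by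
  refine ContinuousOn.congr ?_ hf.eq_add_integral
  exact continuousOn_const.add ((intervalIntegral.continuousOn_primitive_interval'
    hf.intervalIntegrable left_mem_uIcc).mono Icc_subset_uIcc)

theorem prodMk [CompleteSpace E] [CompleteSpace F] (hf : IsPrimitiveOn f φ a b)
    (hg : IsPrimitiveOn g γ a b) :
    IsPrimitiveOn (fun s => (f s, g s)) (fun r => (φ r, γ r)) a b := by
  refine ⟨⟨hf.1.1.prodMk hg.1.1, hf.1.2.prodMk hg.1.2⟩, fun s hs => ?_⟩
  have ha : a ∈ Icc a b := left_mem_Icc.2 (hs.1.trans hs.2)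
  simp only [intervalIntegral.integral_of_le hs.1]
  rw [integral_pair (hf.intervalIntegrable_of_mem ha hs).1 (hg.intervalIntegrable_of_mem ha hs).1,
    hf.eq_add_integral s hs, hg.eq_add_integral s hs, Prod.mk_add_mk,
    intervalIntegral.integral_of_le hs.1, intervalIntegral.integral_of_le hs.1]

theorem absolutelyContinuousOnInterval (hf : IsPrimitiveOn f φ a b) (hab : a ≤ b) :
    AbsolutelyContinuousOnInterval f a b := by
  refine absolutelyContinuousOnInterval_of_dist_le 1
    (hf.intervalIntegrable.norm.absolutelyContinuousOnInterval_intervalIntegral left_mem_uIcc) ?_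
  rw [uIcc_of_le hab]
  intro x hx y hy
  have ha : a ∈ Icc a b := left_mem_Icc.2 hab
  rw [dist_eq_norm, hf.sub_eq_integral hx hy, one_mul, Real.dist_eq,
    intervalIntegral.integral_interval_sub_left (hf.intervalIntegrable_of_mem ha hx).norm
      (hf.intervalIntegrable_of_mem ha hy).norm]
  exact intervalIntegral.norm_integral_le_abs_integral_norm

theorem ae_hasDerivAt [CompleteSpace E] (hf : IsPrimitiveOn f φ a b) :
    ∀ᵐ x, x ∈ Ioo a b → HasDerivAt f (φ x) x := by
  filter_upwards [hf.intervalIntegrable.ae_hasDerivAt_integral] with x hx hxI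
  have hprim := hx (Icc_subset_uIcc (Ioo_subset_Icc_self hxI)) a left_mem_uIcc
  refine (hprim.const_add (f a)).congr_of_eventuallyEq ?_
  filter_upwards [Icc_mem_nhds hxI.1 hxI.2] with s hs using hf.eq_add_integral s hs

theorem of_absolutelyContinuousOnInterval [CompleteSpace E]
    (hf : AbsolutelyContinuousOnInterval f a b) (hφ : IntervalIntegrable φ volume a b)
    (hderiv : ∀ᵐ x, x ∈ Ioo a b → HasDerivAt f (φ x) x) : IsPrimitiveOn f φ a b := by
  refine ⟨hφ, fun s hs => ?_⟩
  have hab : a ≤ b := hs.1.trans hs.2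
  have hprim : IsPrimitiveOn (fun s => ∫ r in a..s, φ r) φ a b :=
    .of_eq_add_integral hab hφ fun s _ => (zero_add _).symm
  obtain ⟨C, hC⟩ := (hf.fun_sub
      (hprim.absolutelyContinuousOnInterval hab)).const_of_ae_hasDerivAt_zero <| by
    filter_upwards [hderiv, hprim.ae_hasDerivAt, compl_mem_ae_iff.2 (measure_singleton a),
      compl_mem_ae_iff.2 (measure_singleton b)] with x hf' hprim' hxa hxb hx
    rw [uIcc_of_le hab] at hx
    have hxI : x ∈ Ioo a b := ⟨hx.1.lt_of_ne' hxa, hx.2.lt_of_ne hxb⟩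
    simpa only [sub_self] using (hf' hxI).fun_sub (hprim' hxI)
  have hs' := (hC s (Icc_subset_uIcc hs)).trans (hC a left_mem_uIcc).symm
  rw [intervalIntegral.integral_same, sub_zero, sub_eq_iff_eq_add] at hs'
  exact hs'

theorem comp_contDiff [CompleteSpace E] [CompleteSpace F] (hab : a ≤ b)
    (hf : IsPrimitiveOn f φ a b) {Ψ : E → F} (hΨ : ContDiff ℝ 1 Ψ) :
    IsPrimitiveOn (fun s => Ψ (f s)) (fun r => fderiv ℝ Ψ (f r) (φ r)) a b := by
  have hlip : LocallyLipschitzOn (f '' Icc a b) Ψ := hΨ.locallyLipschitz.locallyLipschitzOn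
  obtain ⟨K, hK⟩ := hlip.exists_lipschitzOnWith_of_compact
    (isCompact_Icc.image_of_continuousOn hf.continuousOn)
  refine of_absolutelyContinuousOnInterval
    (absolutelyContinuousOnInterval_of_dist_le K (hf.absolutelyContinuousOnInterval hab) ?_)
    (intervalIntegrable_clm_apply hab
      ((hΨ.continuous_fderiv one_ne_zero).comp_continuousOn hf.continuousOn)
      hf.intervalIntegrable) ?_
  · rw [uIcc_of_le hab]
    exact fun x hx y hy => hK.dist_le_mul _ (mem_image_of_mem f hx) _ (mem_image_of_mem f hy)
  · filter_upwards [hf.ae_hasDerivAt] with x hx hxI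
    exact (hΨ.differentiable one_ne_zero (f x)).hasFDerivAt.comp_hasDerivAt x (hx hxI)

theorem bilin [CompleteSpace E] [CompleteSpace F] [CompleteSpace G] (B : E →L[ℝ] F →L[ℝ] G)
    (hab : a ≤ b) (hf : IsPrimitiveOn f φ a b) (hg : IsPrimitiveOn g γ a b) :
    IsPrimitiveOn (fun s => B (f s) (g s)) (fun r => B (f r) (γ r) + B (φ r) (g r)) a b := by
  have h := (hf.prodMk hg).comp_contDiff hab B.isBoundedBilinearMap.contDiff
  simpa only [B.isBoundedBilinearMap.fderiv, IsBoundedBilinearMap.deriv_apply] using h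

end IsPrimitiveOn

end IntegralCalculus

section Volterra

variable {E : Type*} [NormedAddCommGroup E] [NormedSpace ℝ E] {a b : ℝ}

theorem integral_mul_exp_integral (hab : a ≤ b) {ℓ : ℝ → ℝ} (hℓ : IntervalIntegrable ℓ volume a b)
    {s : ℝ} (hs : s ∈ Icc a b) :
    ∫ r in a..s, ℓ r * Real.exp (2 * ∫ r' in a..r, ℓ r') =
      (Real.exp (2 * ∫ r in a..s, ℓ r) - 1) / 2 := by
  have hprim : IsPrimitiveOn (fun s => ∫ r in a..s, ℓ r) ℓ a b :=
    .of_eq_add_integral hab hℓ fun s _ => (zero_add _).symm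
  have hΨ : ContDiff ℝ 1 fun y : ℝ => Real.exp (2 * y) / 2 := by fun_prop
  have hderiv : ∀ y h, fderiv ℝ (fun y : ℝ => Real.exp (2 * y) / 2) y h
      = h * Real.exp (2 * y) := by
    intro y h
    have := ((hasDerivAt_const_mul (x := y) (2 : ℝ)).exp.div_const 2).hasFDerivAt.fderiv
    rw [this, ContinuousLinearMap.toSpanSingleton_apply, smul_eq_mul]
    ring
  have h := (hprim.comp_contDiff hab hΨ).sub_eq_integral hs (left_mem_Icc.2 hab)
  simp only [hderiv, intervalIntegral.integral_same, mul_zero, Real.exp_zero] at h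
  rw [← h]
  ring

/-- The function `s ↦ ∫ r in a..s, φ r` as a continuous function on `[a, b]`. -/
def cumulativeIntegral (hab : a ≤ b) {φ : ℝ → E} (hφ : IntervalIntegrable φ volume a b) :
    C(Icc a b, E) where
  toFun s := ∫ r in a..s, φ r
  continuous_toFun := by
    have h := intervalIntegral.continuousOn_primitive_interval' hφ left_mem_uIcc
    rw [uIcc_of_le hab] at h
    exact continuousOn_iff_continuous_domRestrict.1 h

/-- The weight `exp (c ∫_a^s ℓ)`. In the norm weighted by its value at `c = -2` (Bielecki's norm),
Volterra operators with Lipschitz kernel `ℓ` are contractions. -/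
def bieleckiWeight (hab : a ≤ b) {ℓ : ℝ → ℝ} (hℓ : IntervalIntegrable ℓ volume a b) (c : ℝ) :
    C(Icc a b, ℝ) where
  toFun s := Real.exp (c * cumulativeIntegral hab hℓ s)

theorem bieleckiWeight_apply (hab : a ≤ b) {ℓ : ℝ → ℝ} (hℓ : IntervalIntegrable ℓ volume a b)
    (c : ℝ) (s : Icc a b) : bieleckiWeight hab hℓ c s = Real.exp (c * ∫ r in a..s, ℓ r) :=
  rfl

theorem bieleckiWeight_smul_smul (hab : a ≤ b) {ℓ : ℝ → ℝ} (hℓ : IntervalIntegrable ℓ volume a b)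
    (c : ℝ) (X : C(Icc a b, E)) :
    bieleckiWeight hab hℓ c • bieleckiWeight hab hℓ (-c) • X = X := by
  ext s
  simp [bieleckiWeight_apply, smul_smul, ← Real.exp_add]

theorem norm_bieleckiWeight_smul_sub_le (hab : a ≤ b) {ℓ : ℝ → ℝ}
    (hℓ : IntervalIntegrable ℓ volume a b) (hℓ₀ : ∀ r, 0 ≤ ℓ r) {V : C(Icc a b, E) → C(Icc a b, E)}
    (hV : ∀ X Y s, ‖V X s - V Y s‖ ≤ ∫ r in a..s, ℓ r * ‖IccExtend hab (X - Y) r‖)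
    (X Y : C(Icc a b, E)) :
    ‖bieleckiWeight hab hℓ (-2) • V (bieleckiWeight hab hℓ 2 • X)
      - bieleckiWeight hab hℓ (-2) • V (bieleckiWeight hab hℓ 2 • Y)‖ ≤ 2⁻¹ * ‖X - Y‖ := by
  rw [← smul_sub]
  refine (ContinuousMap.norm_le _ (by positivity)).2 fun s => ?_
  set Λ : ℝ → ℝ := fun s => ∫ r in a..s, ℓ r
  have hs : uIcc a (s : ℝ) ⊆ uIcc a b := uIcc_subset_uIcc_left (Icc_subset_uIcc s.2)
  have hΛ : ContinuousOn Λ (Icc a b) :=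
    (intervalIntegral.continuousOn_primitive_interval' hℓ left_mem_uIcc).mono Icc_subset_uIcc
  have hint : ∀ {g : ℝ → ℝ}, ContinuousOn g (Icc a b) →
      IntervalIntegrable (fun r => ℓ r * g r) volume a s := fun hg =>
    (hℓ.mul_continuousOn (by rwa [uIcc_of_le hab])).mono_set hs
  have hbound : ∀ r ∈ Icc a (s : ℝ), ‖IccExtend hab (bieleckiWeight hab hℓ 2 • X
      - bieleckiWeight hab hℓ 2 • Y) r‖ ≤ Real.exp (2 * Λ r) * ‖X - Y‖ := by
    intro r hr
    rw [← smul_sub, IccExtend_of_mem hab _ ⟨hr.1, hr.2.trans s.2.2⟩]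
    simp only [ContinuousMap.smul_apply', bieleckiWeight_apply, norm_smul, Real.norm_eq_abs,
      Real.abs_exp]
    gcongr
    exact (X - Y).norm_coe_le_norm _
  calc ‖Real.exp (-2 * Λ s) • (V (bieleckiWeight hab hℓ 2 • X) s
        - V (bieleckiWeight hab hℓ 2 • Y) s)‖
      ≤ Real.exp (-2 * Λ s) * ∫ r in a..s, ℓ r * (Real.exp (2 * Λ r) * ‖X - Y‖) := by
        rw [norm_smul, Real.norm_eq_abs, Real.abs_exp]
        gcongr
        refine (hV _ _ s).trans (intervalIntegral.integral_mono_on s.2.1 (hint ?_) (hint ?_) ?_)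
        · exact (ContinuousMap.continuous _).Icc_extend' |>.norm.continuousOn
        · exact ((hΛ.const_mul 2).rexp).mul_const _
        · exact fun r hr => mul_le_mul_of_nonneg_left (hbound r hr) (hℓ₀ r)
    _ = (1 - Real.exp (-2 * Λ s)) / 2 * ‖X - Y‖ := by
        simp only [← mul_assoc, intervalIntegral.integral_mul_const]
        rw [integral_mul_exp_integral hab hℓ s.2, mul_div_assoc', mul_sub, ← Real.exp_add,
          neg_mul, neg_add_cancel, Real.exp_zero, mul_one]
    _ ≤ 2⁻¹ * ‖X - Y‖ := by
        have := Real.exp_nonneg (-2 * Λ s)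
        gcongr
        linarith

variable [CompleteSpace E]

theorem existsUnique_volterra (hab : a ≤ b) {ℓ : ℝ → ℝ} (hℓ : IntervalIntegrable ℓ volume a b)
    (hℓ₀ : ∀ r, 0 ≤ ℓ r) {V : C(Icc a b, E) → C(Icc a b, E)}
    (hV : ∀ X Y s, ‖V X s - V Y s‖ ≤ ∫ r in a..s, ℓ r * ‖IccExtend hab (X - Y) r‖) :
    ∃! X, V X = X := by
  set w := bieleckiWeight hab hℓ
  have hw : ∀ X : C(Icc a b, E), w 2 • w (-2) • X = X := bieleckiWeight_smul_smul hab hℓ 2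
  have hcontr : ContractingWith 2⁻¹ fun X => w (-2) • V (w 2 • X) :=
    ⟨NNReal.inv_lt_one_iff two_ne_zero |>.2 one_lt_two, LipschitzWith.of_dist_le_mul fun X Y => by
      simpa [dist_eq_norm] using norm_bieleckiWeight_smul_sub_le hab hℓ hℓ₀ hV X Y⟩
  refine ⟨w 2 • hcontr.fixedPoint, ?_, fun X hX => ?_⟩
  · have hfix : w (-2) • V (w 2 • hcontr.fixedPoint) = hcontr.fixedPoint :=
      hcontr.fixedPoint_isFixedPt
    exact (hw _).symm.trans (congrArg (w 2 • ·) hfix)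
  · have hfix : Function.IsFixedPt (fun X => w (-2) • V (w 2 • X)) (w (-2) • X) := by
      rw [Function.IsFixedPt, hw, hX]
    rw [← hcontr.fixedPoint_unique hfix, hw]

theorem existsUnique_linear_volterra (hab : a ≤ b) {M : ℝ → E →L[ℝ] E}
    (hM : IntervalIntegrable M volume a b) (c : C(Icc a b, E)) :
    ∃! h : C(Icc a b, E), ∀ s, h s = c s + ∫ r in a..s, M r (IccExtend hab h r) := by
  have hMh (h : C(Icc a b, E)) :
      IntervalIntegrable (fun r => M r (IccExtend hab h r)) volume a b :=
    intervalIntegrable_bilin (ContinuousLinearMap.apply ℝ E) hab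
      h.continuous.Icc_extend'.continuousOn hM
  have hsub (s : Icc a b) : uIcc a (s : ℝ) ⊆ uIcc a b :=
    uIcc_subset_uIcc_left (Icc_subset_uIcc s.2)
  let V (h : C(Icc a b, E)) : C(Icc a b, E) := c + cumulativeIntegral hab (hMh h)
  have hV : ∀ X Y s, ‖V X s - V Y s‖ ≤ ∫ r in a..s, ‖M r‖ * ‖IccExtend hab (X - Y) r‖ := by
    intro X Y s
    have hsub' : V X s - V Y s = ∫ r in a..s, M r (IccExtend hab (X - Y) r) := by
      refine (add_sub_add_left_eq_sub _ _ _).trans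
        ((intervalIntegral.integral_sub ((hMh X).mono_set (hsub s))
          ((hMh Y).mono_set (hsub s))).symm.trans ?_)
      simp only [← map_sub]
      rfl
    rw [hsub']
    exact intervalIntegral.norm_integral_le_of_norm_le s.2.1
      (.of_forall fun r _ => (M r).le_opNorm _)
      ((hM.norm.mul_continuousOn
        (X - Y).continuous.Icc_extend'.norm.continuousOn).mono_set (hsub s))
  obtain ⟨h, hh, huniq⟩ := existsUnique_volterra hab hM.norm (fun r => norm_nonneg (M r)) hV
  exact ⟨h, fun s => DFunLike.congr_fun hh.symm s,
    fun k hk => huniq k (ContinuousMap.ext fun s => (hk s).symm)⟩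

end Volterra

section SquareIntegrable

/-- The space `L²(a, b; E)`, with the same encoding as `ControlSpace`. -/
abbrev L2Ioc (E : Type*) [NormedAddCommGroup E] (a b : ℝ) : Type _ :=
  Lp E 2 ((volume : Measure ℝ).restrict (Ioc a b))

variable {E V : Type*} [NormedAddCommGroup E] [NormedAddCommGroup V] {a b : ℝ}

theorem L2Ioc.intervalIntegrable (hab : a ≤ b) (f : L2Ioc E a b) :
    IntervalIntegrable f volume a b :=
  (intervalIntegrable_iff_integrableOn_Ioc_of_le hab).2 ((Lp.memLp f).integrable one_le_two)

theorem memLp_IccExtend (hab : a ≤ b) (p : ℝ≥0∞) (X : C(Icc a b, E)) :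
    MemLp (IccExtend hab X) p (volume.restrict (Ioc a b)) :=
  memLp_Ioc_of_continuousOn X.continuous.Icc_extend'.continuousOn p

theorem integral_norm_le_norm_L2 (f : L2Ioc E a b) :
    ∫ r in Ioc a b, ‖f r‖ ≤ (ENNReal.ofReal (b - a) ^ (1 / 2 : ℝ)).toReal * ‖f‖ := by
  have hle := eLpNorm_le_eLpNorm_mul_rpow_measure_univ one_le_two (Lp.aestronglyMeasurable f)
  norm_num at hle
  rw [integral_norm_eq_lintegral_enorm (Lp.aestronglyMeasurable f),
    ← eLpNorm_one_eq_lintegral_enorm, Lp.norm_def, ← ENNReal.toReal_mul, mul_comm]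
  exact ENNReal.toReal_mono
    (ENNReal.mul_ne_top (Lp.eLpNorm_ne_top f) (by finiteness)) hle

variable [NormedSpace ℝ E] [NormedSpace ℝ V]

theorem intervalIntegral_congr_ae_restrict {f g : ℝ → E}
    (h : f =ᵐ[volume.restrict (Ioc a b)] g) {s : ℝ} (hs : s ∈ Icc a b) :
    ∫ r in a..s, f r = ∫ r in a..s, g r := by
  rw [intervalIntegral.integral_of_le hs.1, intervalIntegral.integral_of_le hs.1]
  exact integral_congr_ae (ae_restrict_of_ae_restrict_of_subset (Ioc_subset_Ioc_right hs.2) h)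

variable (hab : a ≤ b)

/-- Continuous functions on `[a, b]` as elements of `Lᵖ(a, b)`. -/
def continuousToLp (p : ℝ≥0∞) [Fact (1 ≤ p)] :
    C(Icc a b, E) →L[ℝ] Lp E p ((volume : Measure ℝ).restrict (Ioc a b)) :=
  LinearMap.mkContinuous
    { toFun := fun X => (memLp_IccExtend hab p X).toLp
      map_add' := fun _ _ => rfl
      map_smul' := fun _ _ => rfl }
    ((volume.restrict (Ioc a b)).real univ ^ p.toReal⁻¹) fun X =>
      Lp.norm_le_of_ae_bound (norm_nonneg X) <| by
        filter_upwards [(memLp_IccExtend hab p X).coeFn_toLp] with r hr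
        exact (congrArg norm hr).trans_le (X.norm_coe_le_norm _)

theorem coeFn_continuousToLp (p : ℝ≥0∞) [Fact (1 ≤ p)] (X : C(Icc a b, E)) :
    continuousToLp hab p X =ᵐ[volume.restrict (Ioc a b)] IccExtend hab X :=
  (memLp_IccExtend hab p X).coeFn_toLp

/-- Pointwise application of continuous operator-valued functions to square-integrable ones. -/
def applyL2 : C(Icc a b, V →L[ℝ] E) →L[ℝ] L2Ioc V a b →L[ℝ] L2Ioc E a b :=
  ((ContinuousLinearMap.apply ℝ E).flip.holderL _ ∞ 2 2).comp (continuousToLp hab ∞)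

theorem coeFn_applyL2 (L : C(Icc a b, V →L[ℝ] E)) (u : L2Ioc V a b) :
    applyL2 hab L u =ᵐ[volume.restrict (Ioc a b)] fun r => IccExtend hab L r (u r) := by
  filter_upwards [(ContinuousLinearMap.apply ℝ E).flip.coeFn_holder (r := 2)
    (continuousToLp hab ∞ L) u, coeFn_continuousToLp hab ∞ L] with r hholder hL
  exact hholder.trans (congrArg (· (u r)) hL)

/-- The primitive `s ↦ ∫_a^s f` of a square-integrable function, as a continuous function. -/
def primitive : L2Ioc E a b →L[ℝ] C(Icc a b, E) :=
  LinearMap.mkContinuous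
    { toFun := fun f => cumulativeIntegral hab (f.intervalIntegrable hab)
      map_add' := fun f g => by
        ext s
        have hsub : uIcc a (s : ℝ) ⊆ uIcc a b := uIcc_subset_uIcc_left (Icc_subset_uIcc s.2)
        exact (intervalIntegral_congr_ae_restrict (Lp.coeFn_add f g) s.2).trans
          (intervalIntegral.integral_add ((f.intervalIntegrable hab).mono_set hsub)
            ((g.intervalIntegrable hab).mono_set hsub))
      map_smul' := fun c f => by
        ext s
        exact (intervalIntegral_congr_ae_restrict (Lp.coeFn_smul c f) s.2).trans
          (intervalIntegral.integral_smul c f) }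
    (ENNReal.ofReal (b - a) ^ (1 / 2 : ℝ)).toReal fun f => by
      refine (ContinuousMap.norm_le _ (by positivity)).2 fun s => ?_
      calc ‖∫ r in a..s, f r‖ ≤ ∫ r in Ioc a s, ‖f r‖ := by
            rw [intervalIntegral.integral_of_le s.2.1]
            exact norm_integral_le_integral_norm _
        _ ≤ ∫ r in Ioc a b, ‖f r‖ := setIntegral_mono_set
            ((intervalIntegrable_iff_integrableOn_Ioc_of_le hab).1
              (f.intervalIntegrable hab)).norm
            (.of_forall fun _ => norm_nonneg _) (Ioc_subset_Ioc_right s.2.2).eventuallyLE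
        _ ≤ _ := integral_norm_le_norm_L2 f

theorem primitive_apply (f : L2Ioc E a b) (s : Icc a b) :
    primitive hab f s = ∫ r in a..s, f r :=
  rfl

/-- The function `r ↦ c r + L r (u r)`, as an element of `L²(a, b; E)`. -/
def affineRate (c : C(Icc a b, E)) (L : C(Icc a b, V →L[ℝ] E)) (u : L2Ioc V a b) : L2Ioc E a b :=
  continuousToLp hab 2 c + applyL2 hab L u

theorem coeFn_affineRate (c : C(Icc a b, E)) (L : C(Icc a b, V →L[ℝ] E)) (u : L2Ioc V a b) :
    affineRate hab c L u =ᵐ[volume.restrict (Ioc a b)] fun r =>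
      IccExtend hab c r + IccExtend hab L r (u r) :=
  (Lp.coeFn_add _ _).trans ((coeFn_continuousToLp hab 2 c).add (coeFn_applyL2 hab L u))

theorem hasJet2_affineRate {c : ℝ → C(Icc a b, E)} {c₁ c₂ : C(Icc a b, E)}
    {L : ℝ → C(Icc a b, V →L[ℝ] E)} {L₁ L₂ : C(Icc a b, V →L[ℝ] E)} (hc : HasJet2 c c₁ c₂)
    (hL : HasJet2 L L₁ L₂) (u v : L2Ioc V a b) :
    HasJet2 (fun ε => affineRate hab (c ε) (L ε) (u + ε • v))
      (affineRate hab c₁ L₁ u + applyL2 hab (L 0) v)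
      (affineRate hab c₂ L₂ u + (2 : ℝ) • applyL2 hab L₁ v) := by
  have h := (hc.clm_apply (continuousToLp hab 2)).add (hL.bilin (applyL2 hab) (.line u v))
  simpa only [affineRate, zero_smul, add_zero, map_zero, add_assoc] using h

end SquareIntegrable

section StateEquation

theorem contDiff_of_unique_zero {U X Y : Type*} [NormedAddCommGroup U] [NormedSpace ℝ U]
    [CompleteSpace U] [NormedAddCommGroup X] [NormedSpace ℝ X] [CompleteSpace X]
    [NormedAddCommGroup Y] [NormedSpace ℝ Y] [CompleteSpace Y] {n : WithTop ℕ∞} (hn : n ≠ 0)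
    {F : U × X → Y} (hF : ContDiff ℝ n F) {σ : U → X} (hσ : ∀ u x, F (u, x) = 0 ↔ x = σ u)
    (hinv : ∀ u, (fderiv ℝ F (u, σ u) ∘L .inr ℝ U X).IsInvertible) : ContDiff ℝ n σ := by
  refine contDiff_iff_contDiffAt.2 fun u => ?_
  have hFu : ContDiffAt ℝ n F (u, σ u) := hF.contDiffAt
  refine (hFu.contDiffAt_implicitFunction hn (hinv u)).congr_of_eventuallyEq ?_
  filter_upwards [hFu.eventually_apply_implicitFunction hn (hinv u)] with w hw
  rw [(hσ u _).2 rfl, hσ] at hw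
  exact hw.symm

/-- Lipschitz continuity of a coefficient in the space variable, uniformly in the parameter. -/
def C2Coeff.UniformlyLipschitz {K E V : Type*} [TopologicalSpace K] [NormedAddCommGroup E]
    [NormedSpace ℝ E] [NormedAddCommGroup V] [NormedSpace ℝ V] (g : C2Coeff K E V) : Prop :=
  ∃ κ : ℝ≥0, ∀ s, LipschitzWith κ fun x => g.f₀ (s, x)

variable {E V : Type*} [NormedAddCommGroup E] [NormedSpace ℝ E]
  [NormedAddCommGroup V] [NormedSpace ℝ V] {a b : ℝ} (hab : a ≤ b)
  (A : C2Coeff (Icc a b) E E) (B : C2Coeff (Icc a b) E (V →L[ℝ] E))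

/-- The right-hand side of the integrated state equation. -/
def picard (x : E) (u : L2Ioc V a b) (X : C(Icc a b, E)) : C(Icc a b, E) :=
  .const _ x + primitive hab (affineRate hab (superpose A.f₀ X) (superpose B.f₀ X) u)

/-- The rate of the linearized state equation, as a function of the variation of the state. -/
def linearizedRate (X : C(Icc a b, E)) (u : L2Ioc V a b) : C(Icc a b, E) →L[ℝ] L2Ioc E a b :=
  (continuousToLp hab 2).comp (pointwiseApply (superpose A.f₁ X))
    + ((applyL2 hab).flip u).comp (pointwiseApply (superpose B.f₁ X))

theorem contDiff_picard (x : E) :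
    ContDiff ℝ 2 fun p : L2Ioc V a b × C(Icc a b, E) => picard hab A B x p.1 p.2 := by
  have hA : ContDiff ℝ 2 fun p : L2Ioc V a b × C(Icc a b, E) => superpose A.f₀ p.2 :=
    A.contDiff_superpose.comp contDiff_snd
  have hB : ContDiff ℝ 2 fun p : L2Ioc V a b × C(Icc a b, E) => superpose B.f₀ p.2 :=
    B.contDiff_superpose.comp contDiff_snd
  unfold picard affineRate
  fun_prop

theorem hasFDerivAt_picard (x : E) (u : L2Ioc V a b) (X : C(Icc a b, E)) :
    HasFDerivAt (picard hab A B x u) ((primitive hab).comp (linearizedRate hab A B X u)) X := by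
  have hA := (continuousToLp hab 2).hasFDerivAt.comp X
    (hasFDerivAt_superpose A.f₀ A.f₁ A.hasFDerivAt₀ X)
  have hB := ((applyL2 hab).flip u).hasFDerivAt.comp X
    (hasFDerivAt_superpose B.f₀ B.f₁ B.hasFDerivAt₀ X)
  exact ((primitive hab).hasFDerivAt.comp X (hA.add hB)).const_add _

theorem hasJet2_picard (x : E) (u v : L2Ioc V a b) {X : ℝ → C(Icc a b, E)} {X₁ X₂ : C(Icc a b, E)}
    (hX : HasJet2 X X₁ X₂) :
    HasJet2 (fun ε => picard hab A B x (u + ε • v) (X ε))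
      (primitive hab (affineRate hab (A.jet₁ (X 0) X₁) (B.jet₁ (X 0) X₁) u
        + applyL2 hab (superpose B.f₀ (X 0)) v))
      (primitive hab (affineRate hab (A.jet₂ (X 0) X₁ X₂) (B.jet₂ (X 0) X₁ X₂) u
        + (2 : ℝ) • applyL2 hab (B.jet₁ (X 0) X₁) v)) := by
  have h := (HasJet2.const (ContinuousMap.const (Icc a b) x)).add
    ((hasJet2_affineRate hab (hX.superpose A) (hX.superpose B) u v).clm_apply (primitive hab))
  rwa [zero_add, zero_add] at h

variable [CompleteSpace E]

theorem bijective_id_sub_primitive_linearizedRate (X : C(Icc a b, E)) (u : L2Ioc V a b) :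
    Function.Bijective (ContinuousLinearMap.id ℝ C(Icc a b, E)
      - (primitive hab).comp (linearizedRate hab A B X u)) := by
  let M (r : ℝ) : E →L[ℝ] E :=
    IccExtend hab (superpose A.f₁ X) r + (IccExtend hab (superpose B.f₁ X) r).flip (u r)
  have hM : IntervalIntegrable M volume a b := by
    refine .add ((ContinuousMap.continuous _).Icc_extend'.intervalIntegrable _ _) ?_
    exact intervalIntegrable_clm_apply hab ((ContinuousLinearMap.flipₗᵢ ℝ E V E).continuous.comp
      (ContinuousMap.continuous _).Icc_extend').continuousOn (u.intervalIntegrable hab)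
  have hrate (h : C(Icc a b, E)) (s : Icc a b) : primitive hab (linearizedRate hab A B X u h) s
      = ∫ r in a..s, M r (IccExtend hab h r) :=
    intervalIntegral_congr_ae_restrict (coeFn_affineRate hab (A.jet₁ X h) (B.jet₁ X h) u) s.2
  refine Function.bijective_iff_existsUnique _ |>.2 fun c => ?_
  simpa only [sub_apply, ContinuousLinearMap.id_apply, ContinuousLinearMap.comp_apply,
    sub_eq_iff_eq_add, ContinuousMap.ext_iff, ContinuousMap.add_apply, hrate]
    using existsUnique_linear_volterra hab hM c

variable {A B}

theorem existsUnique_state (hA : A.UniformlyLipschitz) (hB : B.UniformlyLipschitz) (x : E)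
    (u : L2Ioc V a b) : ∃! X, picard hab A B x u X = X := by
  obtain ⟨κ, hκ⟩ := hA
  obtain ⟨κ', hκ'⟩ := hB
  have hℓ : IntervalIntegrable (fun r => κ + κ' * ‖u r‖) volume a b :=
    intervalIntegrable_const.add ((u.intervalIntegrable hab).norm.const_mul _)
  refine existsUnique_volterra hab hℓ (fun r => by positivity) fun X Y s => ?_
  have hsub : picard hab A B x u X s - picard hab A B x u Y s = ∫ r in a..s,
      (affineRate hab (superpose A.f₀ X) (superpose B.f₀ X) u
        - affineRate hab (superpose A.f₀ Y) (superpose B.f₀ Y) u : L2Ioc E a b) r := by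
    rw [← primitive_apply, map_sub]
    exact add_sub_add_left_eq_sub _ _ _
  rw [hsub, intervalIntegral_congr_ae_restrict ((Lp.coeFn_sub _ _).trans
    ((coeFn_affineRate hab _ _ u).sub (coeFn_affineRate hab _ _ u))) s.2]
  refine intervalIntegral.norm_integral_le_of_norm_le s.2.1 (.of_forall fun r _ => ?_)
    ((hℓ.mul_continuousOn (X - Y).continuous.Icc_extend'.norm.continuousOn).mono_set
      (uIcc_subset_uIcc_left (Icc_subset_uIcc s.2)))
  set k := projIcc a b hab r
  calc ‖A.f₀ (k, X k) + B.f₀ (k, X k) (u r) - (A.f₀ (k, Y k) + B.f₀ (k, Y k) (u r))‖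
      = ‖A.f₀ (k, X k) - A.f₀ (k, Y k) + (B.f₀ (k, X k) - B.f₀ (k, Y k)) (u r)‖ := by
        rw [sub_apply, add_sub_add_comm]
    _ ≤ κ * ‖X k - Y k‖ + κ' * ‖X k - Y k‖ * ‖u r‖ :=
        norm_add_le_of_le ((hκ k).norm_sub_le _ _)
          (ContinuousLinearMap.le_of_opNorm_le _ ((hκ' k).norm_sub_le _ _) _)
    _ = (κ + κ' * ‖u r‖) * ‖X k - Y k‖ := by ring

/-- The control-to-state map: the state on `[a, b]` driven by a given control. -/
def stateMap (hA : A.UniformlyLipschitz) (hB : B.UniformlyLipschitz) (x : E) (u : L2Ioc V a b) :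
    C(Icc a b, E) :=
  (existsUnique_state hab hA hB x u).choose

theorem picard_eq_self_iff (hA : A.UniformlyLipschitz) (hB : B.UniformlyLipschitz) {x : E}
    {u : L2Ioc V a b} {X : C(Icc a b, E)} :
    picard hab A B x u X = X ↔ X = stateMap hab hA hB x u := by
  have h := (existsUnique_state hab hA hB x u).choose_spec
  exact ⟨h.2 X, fun hX => hX ▸ h.1⟩

theorem contDiff_stateMap [CompleteSpace V] (hA : A.UniformlyLipschitz)
    (hB : B.UniformlyLipschitz) (x : E) : ContDiff ℝ 2 (stateMap hab hA hB x) := by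
  have hF := contDiff_snd.sub (contDiff_picard hab A B x)
  refine contDiff_of_unique_zero two_ne_zero hF (fun u X => ?_) fun u => ?_
  · rw [← picard_eq_self_iff hab hA hB, sub_eq_zero, eq_comm]
  · set X := stateMap hab hA hB x u
    have hpartial := (hF.differentiable two_ne_zero (u, X)).hasFDerivAt.comp X
      (hasFDerivAt_prodMk_right u X)
    rw [hpartial.unique ((hasFDerivAt_id X).sub (hasFDerivAt_picard hab A B x u X))]
    have hbij := bijective_id_sub_primitive_linearizedRate hab A B X u
    exact ⟨.ofBijective _ (LinearMap.ker_eq_bot.2 hbij.1) (LinearMap.range_eq_top.2 hbij.2), rfl⟩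

theorem exists_hasJet2_stateMap [CompleteSpace V] (hA : A.UniformlyLipschitz)
    (hB : B.UniformlyLipschitz) (x : E) (u v : L2Ioc V a b) :
    ∃ X₁ X₂, HasJet2 (fun ε : ℝ => stateMap hab hA hB x (u + ε • v)) X₁ X₂ ∧
      X₁ = primitive hab
        (affineRate hab (A.jet₁ (stateMap hab hA hB x u) X₁) (B.jet₁ (stateMap hab hA hB x u) X₁) u
          + applyL2 hab (superpose B.f₀ (stateMap hab hA hB x u)) v) ∧
      X₂ = primitive hab (affineRate hab (A.jet₂ (stateMap hab hA hB x u) X₁ X₂)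
          (B.jet₂ (stateMap hab hA hB x u) X₁ X₂) u
        + (2 : ℝ) • applyL2 hab (B.jet₁ (stateMap hab hA hB x u) X₁) v) := by
  obtain ⟨X₁, X₂, hX⟩ : ∃ X₁ X₂, HasJet2 (fun ε : ℝ => stateMap hab hA hB x (u + ε • v)) X₁ X₂ :=
    ⟨_, _, (HasJet2.line u v).comp_contDiff (contDiff_stateMap hab hA hB x)⟩
  have hfix (ε : ℝ) := (picard_eq_self_iff hab hA hB (x := x) (u := u + ε • v)).2 rfl
  have hpicard := hasJet2_picard hab A B x u v hX
  simp only [hfix, zero_smul, add_zero] at hpicard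
  exact ⟨X₁, X₂, hX, hX.unique hpicard⟩

end StateEquation

section BolzaCost

theorem L2Ioc.inner_eq_integral {V : Type*} [NormedAddCommGroup V] [InnerProductSpace ℝ V]
    {a b : ℝ} (hab : a ≤ b) {f g : L2Ioc V a b} {φ γ : ℝ → V}
    (hf : f =ᵐ[volume.restrict (Ioc a b)] φ) (hg : g =ᵐ[volume.restrict (Ioc a b)] γ) :
    IntervalIntegrable (fun r => ⟪φ r, γ r⟫_ℝ) volume a b ∧
      ⟪f, g⟫_ℝ = ∫ r in a..b, ⟪φ r, γ r⟫_ℝ := by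
  have hfg : (fun r => ⟪f r, g r⟫_ℝ) =ᵐ[volume.restrict (Ioc a b)] fun r => ⟪φ r, γ r⟫_ℝ := by
    filter_upwards [hf, hg] with r hfr hgr
    rw [hfr, hgr]
  refine ⟨?_, ?_⟩
  · exact (intervalIntegrable_iff_integrableOn_Ioc_of_le hab).2
      ((L2.integrable_inner f g).congr hfg)
  · rw [L2.inner_def, intervalIntegral.integral_of_le hab]
    exact integral_congr_ae hfg

variable {V : Type*} [NormedAddCommGroup V] [InnerProductSpace ℝ V] {a b : ℝ} (hab : a ≤ b)

/-- The functional `∫_a^b (q + ⟨p, u⟩ + ½⟨N u, u⟩)` of the coefficients and the control. -/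
def quadraticCost (q : C(Icc a b, ℝ)) (p : C(Icc a b, V)) (N : C(Icc a b, V →L[ℝ] V))
    (u : L2Ioc V a b) : ℝ :=
  primitive hab (continuousToLp hab 2 q) ⟨b, right_mem_Icc.2 hab⟩
    + ⟪affineRate hab p ((1 / 2 : ℝ) • N) u, u⟫_ℝ

theorem primitive_continuousToLp_right (q : C(Icc a b, ℝ)) :
    primitive hab (continuousToLp hab 2 q) ⟨b, right_mem_Icc.2 hab⟩ =
      ∫ r in a..b, IccExtend hab q r :=
  intervalIntegral_congr_ae_restrict (coeFn_continuousToLp hab 2 q) (right_mem_Icc.2 hab)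

theorem quadraticCost_eq_integral (q : C(Icc a b, ℝ)) (p : C(Icc a b, V))
    (N : C(Icc a b, V →L[ℝ] V)) (u : L2Ioc V a b) :
    quadraticCost hab q p N u = ∫ r in a..b, (IccExtend hab q r + ⟪IccExtend hab p r, u r⟫_ℝ
      + (1 / 2) * ⟪IccExtend hab N r (u r), u r⟫_ℝ) := by
  obtain ⟨hint, hinner⟩ := L2Ioc.inner_eq_integral hab
    (coeFn_affineRate hab p ((1 / 2 : ℝ) • N) u) (EventuallyEq.refl _ u)
  rw [quadraticCost, primitive_continuousToLp_right, hinner,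
    ← intervalIntegral.integral_add (q.continuous.Icc_extend'.intervalIntegrable _ _) hint]
  refine intervalIntegral.integral_congr fun r _ => ?_
  simp only [IccExtend, Function.comp_apply, ContinuousMap.smul_apply, smul_apply,
    inner_add_left, real_inner_smul_left, add_assoc]

/-- The second derivative at `ε = 0` of `q + ⟨p, u + ε v⟩ + ½⟨N (u + ε v), u + ε v⟩`, for curves
`q`, `p` and `N` with the indicated derivatives at `0`. -/
def quadraticRate₂ (q₂ : ℝ) (p₁ p₂ : V) (N N₁ N₂ : V →L[ℝ] V) (u v : V) : ℝ :=
  q₂ + (⟪p₂, u⟫_ℝ + 2 * ⟪p₁, v⟫_ℝ)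
    + ((1 / 2) * ⟪N₂ u, u⟫_ℝ + ⟪N₁ v, u⟫_ℝ + ⟪N₁ u, v⟫_ℝ + ⟪N v, v⟫_ℝ)

theorem primitive_add_inner_add_inner (q : C(Icc a b, ℝ)) {f g u v : L2Ioc V a b} {φ γ : ℝ → V}
    (hf : f =ᵐ[volume.restrict (Ioc a b)] φ) (hg : g =ᵐ[volume.restrict (Ioc a b)] γ)
    {κ : ℝ → ℝ} (hκ : ∀ r, κ r = IccExtend hab q r + (⟪φ r, u r⟫_ℝ + 2 * ⟪γ r, v r⟫_ℝ)) :
    IntervalIntegrable κ volume a b ∧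
      primitive hab (continuousToLp hab 2 q) ⟨b, right_mem_Icc.2 hab⟩
        + (⟪f, u⟫_ℝ + 2 * ⟪g, v⟫_ℝ) = ∫ r in a..b, κ r := by
  obtain ⟨hφ, hfu⟩ := L2Ioc.inner_eq_integral hab hf (EventuallyEq.refl _ u)
  obtain ⟨hγ, hgv⟩ := L2Ioc.inner_eq_integral hab hg (EventuallyEq.refl _ v)
  have hq : IntervalIntegrable (IccExtend hab q) volume a b :=
    q.continuous.Icc_extend'.intervalIntegrable _ _
  rw [funext hκ, primitive_continuousToLp_right, hfu, hgv,
    ← intervalIntegral.integral_const_mul, ← intervalIntegral.integral_add hφ (hγ.const_mul 2),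
    ← intervalIntegral.integral_add hq (hφ.add (hγ.const_mul 2))]
  exact ⟨hq.add (hφ.add (hγ.const_mul 2)), rfl⟩

theorem exists_hasJet2_quadraticCost {q : ℝ → C(Icc a b, ℝ)} {q₁ q₂ : C(Icc a b, ℝ)}
    {p : ℝ → C(Icc a b, V)} {p₁ p₂ : C(Icc a b, V)} {N : ℝ → C(Icc a b, V →L[ℝ] V)}
    {N₁ N₂ : C(Icc a b, V →L[ℝ] V)} (hq : HasJet2 q q₁ q₂) (hp : HasJet2 p p₁ p₂)
    (hN : HasJet2 N N₁ N₂) (u v : L2Ioc V a b) {κ : ℝ → ℝ}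
    (hκ : ∀ r, κ r = quadraticRate₂ (IccExtend hab q₂ r) (IccExtend hab p₁ r)
      (IccExtend hab p₂ r) (IccExtend hab (N 0) r) (IccExtend hab N₁ r) (IccExtend hab N₂ r)
      (u r) (v r)) :
    IntervalIntegrable κ volume a b ∧ ∃ J₁ : ℝ,
      HasJet2 (fun ε => quadraticCost hab (q ε) (p ε) (N ε) (u + ε • v)) J₁
        (∫ r in a..b, κ r) := by
  have hNhalf : HasJet2 (fun ε => (1 / 2 : ℝ) • N ε) ((1 / 2 : ℝ) • N₁) ((1 / 2 : ℝ) • N₂) :=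
    hN.clm_apply ((1 / 2 : ℝ) • ContinuousLinearMap.id ℝ _)
  have hjet := (hq.clm_apply ((ContinuousMap.evalCLM ℝ (⟨b, right_mem_Icc.2 hab⟩ : Icc a b)).comp
    ((primitive hab).comp (continuousToLp hab 2)))).add
      ((hasJet2_affineRate hab hp hNhalf u v).bilin (innerSL ℝ) (.line u v))
  obtain ⟨hint, hintegral⟩ := primitive_add_inner_add_inner hab q₂ (κ := κ) (u := u) (v := v)
    ((Lp.coeFn_add _ _).trans ((coeFn_affineRate hab p₂ ((1 / 2 : ℝ) • N₂) u).add
      ((Lp.coeFn_smul _ _).trans ((coeFn_applyL2 hab ((1 / 2 : ℝ) • N₁) v).const_smul (2 : ℝ)))))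
    ((Lp.coeFn_add _ _).trans ((coeFn_affineRate hab p₁ ((1 / 2 : ℝ) • N₁) u).add
      (coeFn_applyL2 hab ((1 / 2 : ℝ) • N 0) v))) fun r => by
    rw [hκ r]
    simp only [quadraticRate₂, IccExtend, Function.comp_apply, Pi.add_apply, Pi.smul_apply,
      ContinuousMap.smul_apply, smul_apply, inner_add_left, real_inner_smul_left]
    ring
  rw [zero_smul, add_zero, map_zero, add_zero] at hjet
  exact ⟨hint, _, hintegral ▸ hjet⟩

variable {E : Type*} [NormedAddCommGroup E] [NormedSpace ℝ E]

theorem isPrimitiveOn_primitive {f : L2Ioc E a b} {φ : ℝ → E}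
    (h : f =ᵐ[volume.restrict (Ioc a b)] φ) :
    IsPrimitiveOn (IccExtend hab (primitive hab f)) φ a b := by
  refine .of_eq_add_integral hab (c := 0) ?_ fun s hs => ?_
  · exact (intervalIntegrable_iff_integrableOn_Ioc_of_le hab).2
      (((Lp.memLp f).integrable one_le_two).congr h)
  · rw [IccExtend_of_mem hab _ hs, zero_add]
    exact intervalIntegral_congr_ae_restrict h hs

variable (Q : C2Coeff (Icc a b) E ℝ) (S : C2Coeff (Icc a b) E V)
  (R : C2Coeff (Icc a b) E (V →L[ℝ] V))

/-- The Bolza cost of a control `u` and the corresponding state `X`. -/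
def bolzaCost (G : E → ℝ) (X : C(Icc a b, E)) (u : L2Ioc V a b) : ℝ :=
  quadraticCost hab (superpose Q.f₀ X) (superpose S.f₀ X) (superpose R.f₀ X) u
    + G (X ⟨b, right_mem_Icc.2 hab⟩)

theorem contDiff_bolzaCost {G : E → ℝ} (hG : ContDiff ℝ 2 G) {σ : L2Ioc V a b → C(Icc a b, E)}
    (hσ : ContDiff ℝ 2 σ) : ContDiff ℝ 2 fun u => bolzaCost hab Q S R G (σ u) u := by
  have hQ : ContDiff ℝ 2 fun u => superpose Q.f₀ (σ u) := Q.contDiff_superpose.comp hσ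
  have hS : ContDiff ℝ 2 fun u => superpose S.f₀ (σ u) := S.contDiff_superpose.comp hσ
  have hR : ContDiff ℝ 2 fun u => superpose R.f₀ (σ u) := R.contDiff_superpose.comp hσ
  have hrate : ContDiff ℝ 2 fun u =>
      affineRate hab (superpose S.f₀ (σ u)) ((1 / 2 : ℝ) • superpose R.f₀ (σ u)) u := by
    unfold affineRate
    fun_prop
  have hrunning : ContDiff ℝ 2 fun u =>
      primitive hab (continuousToLp hab 2 (superpose Q.f₀ (σ u))) := by fun_prop
  exact (((ContinuousMap.evalCLM ℝ _ : C(Icc a b, ℝ) →L[ℝ] ℝ).contDiff.comp hrunning).add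
    (hrate.inner ℝ contDiff_id)).add
      (hG.comp ((ContinuousMap.evalCLM ℝ _ : C(Icc a b, E) →L[ℝ] E).contDiff.comp hσ))

end BolzaCost

section SecondVariation

theorem intervalIntegral_add_eq_of_forall {a b : ℝ} (hab : a ≤ b) {f g h : ℝ → ℝ}
    (hf : IntervalIntegrable f volume a b) (hg : IntervalIntegrable g volume a b)
    (hfg : ∀ r ∈ Icc a b, f r + g r = h r) :
    IntervalIntegrable h volume a b ∧
      (∫ r in a..b, f r) + ∫ r in a..b, g r = ∫ r in a..b, h r := by
  rw [← uIcc_of_le hab] at hfg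
  refine ⟨(hf.add hg).congr fun r hr => hfg r (uIoc_subset_uIcc hr), ?_⟩
  rw [← intervalIntegral.integral_add hf hg]
  exact intervalIntegral.integral_congr hfg

variable {E V : Type*} [NormedAddCommGroup E] [InnerProductSpace ℝ E] [NormedAddCommGroup V]
  [InnerProductSpace ℝ V] {a b : ℝ} (hab : a ≤ b) (Q : C2Coeff (Icc a b) E ℝ)
  (S : C2Coeff (Icc a b) E V) (R : C2Coeff (Icc a b) E (V →L[ℝ] V)) {G : E → ℝ}
  (A : C2Coeff (Icc a b) E E) (B : C2Coeff (Icc a b) E (V →L[ℝ] E))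

/-- The derivative of the Hamiltonian `⟨y, A + B u⟩ + Q + ⟨S, u⟩ + ½⟨R u, u⟩` at time `k` and
state `x`, in the direction `h` of the state. -/
def hamiltonianDeriv (k : Icc a b) (x y : E) (u : V) (h : E) : ℝ :=
  ⟪y, A.f₁ (k, x) h + B.f₁ (k, x) h u⟫_ℝ + Q.f₁ (k, x) h + ⟪S.f₁ (k, x) h, u⟫_ℝ
    + (1 / 2) * ⟪R.f₁ (k, x) h u, u⟫_ℝ

/-- The second derivative of the Hamiltonian `⟨y, A + B u⟩ + Q + ⟨S, u⟩ + ½⟨R u, u⟩` at time `k`,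
in the direction `h` of the state and `v` of the control, evaluated on the diagonal. -/
def hamiltonianHessian (k : Icc a b) (x y : E) (u : V) (h : E) (v : V) : ℝ :=
  ⟪y, A.f₂ (k, x) h h + B.f₂ (k, x) h h u + (2 : ℝ) • B.f₁ (k, x) h v⟫_ℝ
    + quadraticRate₂ (Q.f₂ (k, x) h h) (S.f₁ (k, x) h) (S.f₂ (k, x) h h) (R.f₀ (k, x))
      (R.f₁ (k, x) h) (R.f₂ (k, x) h h) u v

theorem hamiltonianHessian_eq (k : Icc a b) (x y : E) (u : V) (h h' : E) (v : V) :
    hamiltonianHessian Q S R A B k x y u h v =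
      quadraticRate₂ (Q.f₂ (k, x) h h + Q.f₁ (k, x) h') (S.f₁ (k, x) h)
        (S.f₂ (k, x) h h + S.f₁ (k, x) h') (R.f₀ (k, x)) (R.f₁ (k, x) h)
        (R.f₂ (k, x) h h + R.f₁ (k, x) h') u v
      + (⟪y, A.f₂ (k, x) h h + A.f₁ (k, x) h' + (B.f₂ (k, x) h h + B.f₁ (k, x) h') u
          + (2 : ℝ) • B.f₁ (k, x) h v⟫_ℝ
        - hamiltonianDeriv Q S R A B k x y u h') := by
  simp only [hamiltonianHessian, quadraticRate₂, hamiltonianDeriv, add_apply, inner_add_left,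
    inner_add_right]
  ring

variable {A B} [CompleteSpace E] [CompleteSpace V]

theorem exists_fderiv_fderiv_bolzaCost (hG : ContDiff ℝ 2 G) (hA : A.UniformlyLipschitz)
    (hB : B.UniformlyLipschitz) (x : E) (u v : L2Ioc V a b) {X : C(Icc a b, E)}
    (hX : X = stateMap hab hA hB x u) {Y ρ : ℝ → E}
    (hY : IsPrimitiveOn Y (fun r => -ρ r) a b)
    (hYb : ∀ h, ⟪Y b, h⟫_ℝ = fderiv ℝ G (X ⟨b, right_mem_Icc.2 hab⟩) h)
    (hρ : ∀ r (hr : r ∈ Icc a b) h, ⟪ρ r, h⟫_ℝ =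
      hamiltonianDeriv Q S R A B ⟨r, hr⟩ (X ⟨r, hr⟩) (Y r) (u r) h) :
    ∃ X₁ : C(Icc a b, E),
      X₁ = primitive hab (affineRate hab (A.jet₁ X X₁) (B.jet₁ X X₁) u
        + applyL2 hab (superpose B.f₀ X) v) ∧
      IntervalIntegrable (fun r => hamiltonianHessian Q S R A B (projIcc a b hab r)
        (X (projIcc a b hab r)) (Y r) (u r) (X₁ (projIcc a b hab r)) (v r)) volume a b ∧
      fderiv ℝ (fderiv ℝ fun u => bolzaCost hab Q S R G (stateMap hab hA hB x u) u) u v v =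
        fderiv ℝ (fderiv ℝ G) (X ⟨b, right_mem_Icc.2 hab⟩) (X₁ ⟨b, right_mem_Icc.2 hab⟩)
          (X₁ ⟨b, right_mem_Icc.2 hab⟩)
        + ∫ r in a..b, hamiltonianHessian Q S R A B (projIcc a b hab r)
          (X (projIcc a b hab r)) (Y r) (u r) (X₁ (projIcc a b hab r)) (v r) := by
  obtain ⟨X₁, X₂, hjet, hX₁, hX₂⟩ := exists_hasJet2_stateMap hab hA hB x u v
  have hcost := contDiff_bolzaCost hab Q S R hG (contDiff_stateMap hab hA hB x)
  obtain ⟨hκ, J₁, hJ⟩ := exists_hasJet2_quadraticCost hab (hjet.superpose Q) (hjet.superpose S)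
    (hjet.superpose R) u v fun r => rfl
  have hG' := (hjet.clm_apply (ContinuousMap.evalCLM ℝ
    (⟨b, right_mem_Icc.2 hab⟩ : Icc a b))).comp_contDiff hG
  have key := (((HasJet2.line u v).comp_contDiff hcost).unique (hJ.add hG')).2
  simp only [zero_smul, add_zero, map_zero, ← hX] at key hκ hX₁ hX₂
  have hprim₂ := isPrimitiveOn_primitive hab
    ((Lp.coeFn_add _ _).trans ((coeFn_affineRate hab (A.jet₂ X X₁ X₂) (B.jet₂ X X₁ X₂) u).add
      ((Lp.coeFn_smul _ _).trans ((coeFn_applyL2 hab (B.jet₁ X X₁) v).const_smul (2 : ℝ)))))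
  rw [← hX₂] at hprim₂
  have hYX₂ := hY.bilin (innerSL ℝ) hab hprim₂
  have hdual := hYX₂.sub_eq_integral (right_mem_Icc.2 hab) (left_mem_Icc.2 hab)
  obtain ⟨hint, hadd⟩ := intervalIntegral_add_eq_of_forall hab hκ hYX₂.intervalIntegrable
    (h := fun r => hamiltonianHessian Q S R A B (projIcc a b hab r)
      (X (projIcc a b hab r)) (Y r) (u r) (X₁ (projIcc a b hab r)) (v r)) fun r hr => by
    rw [projIcc_of_mem hab hr, hamiltonianHessian_eq (h' := X₂ ⟨r, hr⟩), ← hρ r hr,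
      sub_eq_add_neg, ← inner_neg_left]
    simp only [Pi.add_apply, Pi.smul_apply, IccExtend_of_mem hab _ hr]
    rfl
  have hX₂a : IccExtend hab X₂ a = 0 := by
    rw [IccExtend_left, hX₂, primitive_apply, intervalIntegral.integral_same]
  rw [← hdual, hX₂a, map_zero, sub_zero, IccExtend_right, innerSL_apply_apply, hYb] at hadd
  refine ⟨X₁, hX₁, hint, ?_⟩
  rw [key, ← hadd]
  simp only [ContinuousMap.evalCLM_apply]
  ring

end SecondVariation

section Gradient

variable {E : Type*} [NormedAddCommGroup E] [InnerProductSpace ℝ E] [CompleteSpace E] {f : E → ℝ}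

theorem contDiff_gradient (hf : ContDiff ℝ 2 f) : ContDiff ℝ 1 (gradient f) :=
  (InnerProductSpace.toDual ℝ E).symm.contDiff.comp (hf.fderiv_right one_add_one_eq_two.le)

theorem inner_fderiv_gradient (hf : ContDiff ℝ 2 f) (x h k : E) :
    ⟪fderiv ℝ (gradient f) x h, k⟫_ℝ = fderiv ℝ (fderiv ℝ f) x h k := by
  have hgrad := ((contDiff_gradient hf).differentiable one_ne_zero x).hasFDerivAt
  have hpair := (hgrad.inner ℝ (hasFDerivAt_const k x)).fderiv
  have hdf := (hf.fderiv_right one_add_one_eq_two.le).differentiable one_ne_zero x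
  simp only [inner_gradient_left] at hpair
  have happly := (hdf.hasFDerivAt.clm_apply (hasFDerivAt_const k x)).fderiv
  simpa using congrArg (fun L : E →L[ℝ] ℝ => L h) (hpair.symm.trans happly)

theorem inner_fderiv_gradient_comm (hf : ContDiff ℝ 2 f) (x h k : E) :
    ⟪fderiv ℝ (gradient f) x h, k⟫_ℝ = ⟪h, fderiv ℝ (gradient f) x k⟫_ℝ := by
  rw [real_inner_comm _ h, inner_fderiv_gradient hf, inner_fderiv_gradient hf]
  exact (hf.contDiffAt.isSymmSndFDerivAt (by simp)) h k

theorem smul_one_le_fderiv_gradient (hf : ContDiff ℝ 2 f) {x : E} {δ : ℝ}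
    (h : ∀ v, δ * ‖v‖ ^ 2 ≤ fderiv ℝ (fderiv ℝ f) x v v) :
    δ • (1 : E →L[ℝ] E) ≤ fderiv ℝ (gradient f) x := by
  rw [ContinuousLinearMap.le_def, ContinuousLinearMap.isPositive_iff]
  refine ⟨fun v w => ?_, fun v => ?_⟩
  · simp only [ContinuousLinearMap.coe_coe, sub_apply, smul_apply, one_apply_eq_self,
      inner_sub_left, inner_sub_right, real_inner_smul_left, real_inner_smul_right,
      inner_fderiv_gradient_comm hf]
  · simp only [sub_apply, smul_apply, one_apply_eq_self, inner_sub_left, real_inner_smul_left,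
      inner_fderiv_gradient hf, real_inner_self_eq_norm_sq]
    exact sub_nonneg.2 (h v)

theorem fderiv_fderiv_clm_comp {E V W : Type*} [NormedAddCommGroup E] [NormedSpace ℝ E]
    [NormedAddCommGroup V] [NormedSpace ℝ V] [NormedAddCommGroup W] [NormedSpace ℝ W] {f : E → V}
    (hf : ContDiff ℝ 2 f) (L : V →L[ℝ] W) (x h k : E) :
    fderiv ℝ (fderiv ℝ fun z => L (f z)) x h k = L (fderiv ℝ (fderiv ℝ f) x h k) := by
  have hfirst : (fderiv ℝ fun z => L (f z)) =
      fun z => ContinuousLinearMap.compL ℝ E V W L (fderiv ℝ f z) :=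
    funext fun z => (L.hasFDerivAt.comp z (hf.differentiable two_ne_zero z).hasFDerivAt).fderiv
  have hdf := (hf.fderiv_right one_add_one_eq_two.le).differentiable one_ne_zero x
  rw [hfirst]
  exact congrArg (fun M : E →L[ℝ] E →L[ℝ] W => M h k)
    ((ContinuousLinearMap.compL ℝ E V W L).hasFDerivAt.comp x hdf.hasFDerivAt).fderiv

theorem inner_hessian_clm_comp {n : ℕ} {V : Type*} [NormedAddCommGroup V] [NormedSpace ℝ V]
    {f : RVec n → V} (hf : ContDiff ℝ 2 f) (L : V →L[ℝ] ℝ) (x h k : RVec n) :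
    ⟪hessian (fun z => L (f z)) x h, k⟫_ℝ = L (fderiv ℝ (fderiv ℝ f) x h k) :=
  (inner_fderiv_gradient (L.contDiff.comp hf) x h k).trans (fderiv_fderiv_clm_comp hf L x h k)

end Gradient

section PartialDerivatives

theorem continuous_comp_Icc_prod {E W : Type*} [TopologicalSpace E] [TopologicalSpace W] {T : ℝ}
    {g : ℝ × E → W} (hg : ContinuousOn g (Icc 0 T ×ˢ univ)) {t : ℝ} (ht : 0 ≤ t) :
    Continuous fun p : Icc t T × E => g (p.1, p.2) :=
  hg.comp_continuous (by fun_prop) fun p => ⟨⟨ht.trans p.1.2.1, p.1.2.2⟩, mem_univ _⟩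

variable {E V : Type*} [NormedAddCommGroup E] [NormedSpace ℝ E] [NormedAddCommGroup V]
  [NormedSpace ℝ V] {T : ℝ} {f : ℝ → E → V}

theorem contDiff_of_contDiffOn_prod {k : WithTop ℕ∞} {I : Set ℝ}
    (hf : ContDiffOn ℝ k (fun p : ℝ × E => f p.1 p.2) (I ×ˢ univ)) {s : ℝ} (hs : s ∈ I) :
    ContDiff ℝ k (f s) :=
  contDiffOn_univ.1 (hf.comp (contDiff_prodMk_right s).contDiffOn fun z _ => ⟨hs, mem_univ z⟩)

theorem contDiffOn_fderiv_prod (hT : 0 < T) {k : ℕ}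
    (hf : ContDiffOn ℝ (k + 1) (fun p : ℝ × E => f p.1 p.2) (Icc 0 T ×ˢ univ)) :
    ContDiffOn ℝ k (fun p : ℝ × E => fderiv ℝ (f p.1) p.2) (Icc 0 T ×ˢ univ) := by
  have hunique : UniqueDiffOn ℝ (Icc 0 T ×ˢ (univ : Set E)) :=
    (uniqueDiffOn_Icc hT).prod uniqueDiffOn_univ
  refine ((hf.fderivWithin hunique le_rfl).clm_comp
    (contDiffOn_const (c := ContinuousLinearMap.inr ℝ ℝ E))).congr fun p hp => ?_
  have hslice : HasFDerivWithinAt (fun z => (p.1, z)) (.inr ℝ ℝ E) univ p.2 :=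
    (hasFDerivAt_prodMk_right p.1 p.2).hasFDerivWithinAt
  have hmaps : MapsTo (fun z : E => (p.1, z)) univ (Icc 0 T ×ˢ univ) := fun z _ =>
    ⟨hp.1, mem_univ z⟩
  have hpartial := (hf.differentiableOn (by simp) p hp).hasFDerivWithinAt.comp p.2 hslice hmaps
  exact (hasFDerivWithinAt_univ.1 hpartial).fderiv

/-- The coefficient on `[t, T]` given by a twice continuously differentiable function on
`[0, T] × E`. -/
def C2Coeff.ofContDiffOn (hT : 0 < T)
    (hf : ContDiffOn ℝ 2 (fun p : ℝ × E => f p.1 p.2) (Icc 0 T ×ˢ univ)) {t : ℝ} (ht : 0 ≤ t) :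
    C2Coeff (Icc t T) E V :=
  have h₁ : ContDiffOn ℝ (1 : ℕ) (fun p : ℝ × E => fderiv ℝ (f p.1) p.2) (Icc 0 T ×ˢ univ) :=
    contDiffOn_fderiv_prod hT (by simpa [one_add_one_eq_two] using hf)
  have h₂ : ContDiffOn ℝ (0 : ℕ) (fun p : ℝ × E => fderiv ℝ (fderiv ℝ (f p.1)) p.2)
      (Icc 0 T ×ˢ univ) :=
    contDiffOn_fderiv_prod (f := fun s => fderiv ℝ (f s)) hT (by simpa using h₁)
  { f₀ := ⟨fun p => f p.1 p.2, continuous_comp_Icc_prod hf.continuousOn ht⟩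
    f₁ := ⟨fun p => fderiv ℝ (f p.1) p.2, continuous_comp_Icc_prod h₁.continuousOn ht⟩
    f₂ := ⟨fun p => fderiv ℝ (fderiv ℝ (f p.1)) p.2, continuous_comp_Icc_prod h₂.continuousOn ht⟩
    hasFDerivAt₀ := fun s x => ((contDiff_of_contDiffOn_prod hf
      ⟨ht.trans s.2.1, s.2.2⟩).differentiable two_ne_zero x).hasFDerivAt
    hasFDerivAt₁ := fun s x => ((contDiff_of_contDiffOn_prod (f := fun s => fderiv ℝ (f s)) h₁
      ⟨ht.trans s.2.1, s.2.2⟩).differentiable one_ne_zero x).hasFDerivAt }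

theorem C2Coeff.uniformlyLipschitz_ofContDiffOn (hT : 0 < T)
    (hf : ContDiffOn ℝ 2 (fun p : ℝ × E => f p.1 p.2) (Icc 0 T ×ˢ univ)) {t : ℝ} (ht : 0 ≤ t)
    {L : ℝ} (hL : ∀ s ∈ Icc 0 T, ∀ x y, ‖f s x - f s y‖ ≤ L * ‖x - y‖) :
    (C2Coeff.ofContDiffOn hT hf ht).UniformlyLipschitz :=
  ⟨L.toNNReal, fun s => LipschitzWith.of_dist_le' fun x y => by
    rw [dist_eq_norm, dist_eq_norm]
    exact hL s ⟨ht.trans s.2.1, s.2.2⟩ x y⟩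

end PartialDerivatives

namespace AQProblem

variable {n m : ℕ} {P : AQProblem n m} (hT : 0 < P.T) (h3 : P.H3) {t : ℝ} (ht : t ∈ Icc 0 P.T)

/-- The coefficient `A` on `[t, T]`. -/
abbrev coeffA : C2Coeff (Icc t P.T) (RVec n) (RVec n) :=
  .ofContDiffOn hT h3.smooth_A ht.1

/-- The coefficient `B` on `[t, T]`. -/
abbrev coeffB : C2Coeff (Icc t P.T) (RVec n) (RMat n m) :=
  .ofContDiffOn hT h3.smooth_B ht.1

/-- The coefficient `Q` on `[t, T]`. -/
abbrev coeffQ : C2Coeff (Icc t P.T) (RVec n) ℝ :=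
  .ofContDiffOn hT h3.smooth_Q ht.1

/-- The coefficient `S` on `[t, T]`. -/
abbrev coeffS : C2Coeff (Icc t P.T) (RVec n) (RVec m) :=
  .ofContDiffOn hT h3.smooth_S ht.1

/-- The coefficient `R` on `[t, T]`. -/
abbrev coeffR : C2Coeff (Icc t P.T) (RVec n) (RMat m m) :=
  .ofContDiffOn hT h3.smooth_R ht.1

section StateAndCost

theorem picard_apply (x : RVec n) (u : ControlSpace m t P.T) (X : C(Icc t P.T, RVec n))
    (s : Icc t P.T) :
    picard ht.2 (coeffA hT h3 ht) (coeffB hT h3 ht) x u X s =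
      x + ∫ r in t..s, (P.A r (IccExtend ht.2 X r) + P.B r (IccExtend ht.2 X r) (u r)) := by
  refine congrArg (x + ·) ((intervalIntegral_congr_ae_restrict
    (coeFn_affineRate ht.2 _ _ u) s.2).trans ?_)
  refine intervalIntegral.integral_congr fun r hr => ?_
  rw [uIcc_of_le s.2.1] at hr
  have hr' : r ∈ Icc t P.T := ⟨hr.1, hr.2.trans s.2.2⟩
  simp only [IccExtend_of_mem ht.2 _ hr']
  rfl

variable {hT h3 ht} (hA : (coeffA hT h3 ht).UniformlyLipschitz)
  (hB : (coeffB hT h3 ht).UniformlyLipschitz)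

theorem isState_stateMap (x : RVec n) (u : ControlSpace m t P.T) :
    P.IsState t x u (IccExtend ht.2 (stateMap ht.2 hA hB x u)) := by
  refine ⟨(stateMap ht.2 hA hB x u).continuous.Icc_extend'.continuousOn, fun s hs => ?_⟩
  rw [← picard_apply hT h3 ht x u _ ⟨s, hs⟩, (picard_eq_self_iff ht.2 hA hB).2 rfl,
    IccExtend_of_mem _ _ hs]

theorem IsState.eq_stateMap {x : RVec n} {u : ControlSpace m t P.T} {X : ℝ → RVec n}
    (hX : P.IsState t x u X) {s : ℝ} (hs : s ∈ Icc t P.T) :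
    X s = stateMap ht.2 hA hB x u ⟨s, hs⟩ := by
  let Z : C(Icc t P.T, RVec n) := ⟨fun s => X s, hX.1.domRestrict⟩
  have hZ : picard ht.2 (coeffA hT h3 ht) (coeffB hT h3 ht) x u Z = Z := by
    ext1 s
    rw [picard_apply]
    refine Eq.trans ?_ (hX.2 s s.2).symm
    refine congrArg (x + ·) (intervalIntegral.integral_congr fun r hr => ?_)
    rw [uIcc_of_le s.2.1] at hr
    simp only [IccExtend_of_mem ht.2 Z (⟨hr.1, hr.2.trans s.2.2⟩ : r ∈ Icc t P.T)]
    rfl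
  rw [← (picard_eq_self_iff ht.2 hA hB).1 hZ]
  rfl

theorem state_eq_stateMap (x : RVec n) (u : ControlSpace m t P.T) {s : ℝ}
    (hs : s ∈ Icc t P.T) : P.state t x u s = stateMap ht.2 hA hB x u ⟨s, hs⟩ := by
  have hex : ∃ X, P.IsState t x u X := ⟨_, isState_stateMap hA hB x u⟩
  have hstate : P.IsState t x u (P.state t x u) := by
    rw [state, dif_pos hex]
    exact hex.choose_spec
  exact hstate.eq_stateMap hA hB hs

theorem J_eq_bolzaCost (x : RVec n) : P.J t x = fun u => bolzaCost ht.2 (coeffQ hT h3 ht)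
    (coeffS hT h3 ht) (coeffR hT h3 ht) P.G (stateMap ht.2 hA hB x u) u := by
  ext1 u
  rw [J, bolzaCost, quadraticCost_eq_integral,
    state_eq_stateMap hA hB x u (right_mem_Icc.2 ht.2)]
  refine congrArg (· + _) (intervalIntegral.integral_congr fun r hr => ?_)
  rw [uIcc_of_le ht.2] at hr
  simp only [state_eq_stateMap hA hB x u hr, IccExtend_of_mem ht.2 _ hr]
  rfl

theorem contDiff_J (hA : (coeffA hT h3 ht).UniformlyLipschitz)
    (hB : (coeffB hT h3 ht).UniformlyLipschitz) (x : RVec n) : ContDiff ℝ 2 (P.J t x) := by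
  rw [J_eq_bolzaCost hA hB]
  exact contDiff_bolzaCost ht.2 _ _ _ h3.smooth_G (contDiff_stateMap ht.2 hA hB x)

end StateAndCost

end AQProblem

section Adjoint

variable {D E F : Type*} [NormedAddCommGroup D] [NormedSpace ℝ D] [NormedAddCommGroup E]
  [InnerProductSpace ℝ E] [CompleteSpace E] [NormedAddCommGroup F] [InnerProductSpace ℝ F]
  [CompleteSpace F]

/-- The adjoint of operators between real Hilbert spaces, as a continuous linear map. -/
def adjointL : (E →L[ℝ] F) →L[ℝ] F →L[ℝ] E :=
  (ContinuousLinearMap.adjoint (𝕜 := ℝ)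
    (E := E) (F := F)).toContinuousLinearEquiv.toContinuousLinearMap

theorem hasFDerivAt_adjoint {f : D → E →L[ℝ] F} {f' : D →L[ℝ] E →L[ℝ] F} {x : D}
    (hf : HasFDerivAt f f' x) : HasFDerivAt (fun z => (f z).adjoint) (adjointL ∘L f') x :=
  (adjointL (E := E) (F := F)).hasFDerivAt.comp x hf

end Adjoint

namespace AQProblem

variable {n m : ℕ} {P : AQProblem n m}

section PointwiseFormulas

theorem bA_apply (h3 : P.H3) {s : ℝ} (hs : s ∈ Icc 0 P.T) (x : RVec n) (u : RVec m) (h : RVec n) :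
    P.bA s x u h = fderiv ℝ (P.A s) x h + fderiv ℝ (P.B s) x h u := by
  have hB := (contDiff_of_contDiffOn_prod h3.smooth_B hs).differentiable two_ne_zero x
  rw [bA, add_apply, fderiv_clm_apply hB (differentiableAt_const u)]
  simp

theorem inner_bA₁ (h3 : P.H3) {s : ℝ} (hs : s ∈ Icc 0 P.T) (x y : RVec n) (u : RVec m)
    (h k : RVec n) :
    ⟪P.bA₁ s x y u h, k⟫_ℝ = ⟪y, fderiv ℝ (fderiv ℝ (P.A s)) x h k⟫_ℝ
      + fderiv ℝ (fderiv ℝ (P.Q s)) x h k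
      + 1 / 2 * ⟪fderiv ℝ (fderiv ℝ (P.R s)) x h k u, u⟫_ℝ
      + (⟪y, fderiv ℝ (fderiv ℝ (P.B s)) x h k u⟫_ℝ
        + ⟪fderiv ℝ (fderiv ℝ (P.S s)) x h k, u⟫_ℝ) := by
  have eA := inner_hessian_clm_comp (contDiff_of_contDiffOn_prod h3.smooth_A hs) (innerSL ℝ y) x h k
  have eQ := inner_fderiv_gradient (contDiff_of_contDiffOn_prod h3.smooth_Q hs) x h k
  have eR := inner_hessian_clm_comp (contDiff_of_contDiffOn_prod h3.smooth_R hs)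
    (((innerSL ℝ).flip u).comp (ContinuousLinearMap.apply ℝ (RVec m) u)) x h k
  have eB := inner_hessian_clm_comp (contDiff_of_contDiffOn_prod h3.smooth_B hs)
    ((innerSL ℝ y).comp (ContinuousLinearMap.apply ℝ (RVec n) u)) x h k
  have eS := inner_hessian_clm_comp (contDiff_of_contDiffOn_prod h3.smooth_S hs)
    ((innerSL ℝ).flip u) x h k
  simp only [bA₁, add_apply, smul_apply, inner_add_left, real_inner_smul_left]
  exact congrArg₂ (· + ·) (congrArg₂ (· + ·) (congrArg₂ (· + ·) eA eQ) (congrArg (1 / 2 * ·) eR))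
    (congrArg₂ (· + ·) eB eS)

theorem inner_bC (h3 : P.H3) {s : ℝ} (hs : s ∈ Icc 0 P.T) (x y : RVec n) (u : RVec m)
    (h : RVec n) (v : RVec m) :
    ⟪P.bC s x y u h, v⟫_ℝ = ⟪fderiv ℝ (P.R s) x h u, v⟫_ℝ + ⟪fderiv ℝ (P.S s) x h, v⟫_ℝ
      + ⟪y, fderiv ℝ (P.B s) x h v⟫_ℝ := by
  have hR := (contDiff_of_contDiffOn_prod h3.smooth_R hs).differentiable two_ne_zero x
  have hB := (contDiff_of_contDiffOn_prod h3.smooth_B hs).differentiable two_ne_zero x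
  have hB' := hasFDerivAt_adjoint hB.hasFDerivAt
  rw [bC, add_apply, add_apply, fderiv_clm_apply hR (differentiableAt_const u),
    fderiv_clm_apply hB'.differentiableAt (differentiableAt_const y), hB'.fderiv]
  simp [inner_add_left, adjointL, ContinuousLinearMap.adjoint_inner_left]

variable (hT : 0 < P.T) (h3 : P.H3) {t : ℝ} (ht : t ∈ Icc 0 P.T) (k : Icc t P.T)

theorem inner_adjointRate (x y : RVec n) (u : RVec m) (h : RVec n) :
    ⟪(P.bA k x u).adjoint y + gradient (P.Q k) x + (fderiv ℝ (P.S k) x).adjoint u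
        + (1 / 2 : ℝ) • gradient (fun z => ⟪P.R k z u, u⟫_ℝ) x, h⟫_ℝ =
      hamiltonianDeriv (coeffQ hT h3 ht) (coeffS hT h3 ht) (coeffR hT h3 ht) (coeffA hT h3 ht)
        (coeffB hT h3 ht) k x y u h := by
  have hk : (k : ℝ) ∈ Icc 0 P.T := ⟨ht.1.trans k.2.1, k.2.2⟩
  have hR := (contDiff_of_contDiffOn_prod h3.smooth_R hk).differentiable two_ne_zero x
  have eR : ⟪gradient (fun z => ⟪P.R k z u, u⟫_ℝ) x, h⟫_ℝ = ⟪fderiv ℝ (P.R k) x h u, u⟫_ℝ := by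
    rw [inner_gradient_left]
    exact congrArg (fun L : RVec n →L[ℝ] ℝ => L h) ((((innerSL ℝ).flip u).comp
      (ContinuousLinearMap.apply ℝ (RVec m) u)).hasFDerivAt.comp x hR.hasFDerivAt).fderiv
  rw [inner_add_left, inner_add_left, inner_add_left, real_inner_smul_left, eR,
    ContinuousLinearMap.adjoint_inner_left, ContinuousLinearMap.adjoint_inner_left,
    bA_apply h3 hk, inner_gradient_left, real_inner_comm _ u]
  rfl

theorem hamiltonianHessian_coeff (hR : ∀ x : RVec n, (P.R k x).adjoint = P.R k x)
    (x y : RVec n) (u : RVec m) (h : RVec n) (v : RVec m) :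
    hamiltonianHessian (coeffQ hT h3 ht) (coeffS hT h3 ht) (coeffR hT h3 ht) (coeffA hT h3 ht)
        (coeffB hT h3 ht) k x y u h v =
      ⟪P.R k x v, v⟫_ℝ + ⟪P.bA₁ k x y u h, h⟫_ℝ + 2 * ⟪P.bC k x y u h, v⟫_ℝ := by
  have hk : (k : ℝ) ∈ Icc 0 P.T := ⟨ht.1.trans k.2.1, k.2.2⟩
  have hdiff := (contDiff_of_contDiffOn_prod h3.smooth_R hk).differentiable two_ne_zero x
  have hsymm : ⟪fderiv ℝ (P.R k) x h v, u⟫_ℝ = ⟪fderiv ℝ (P.R k) x h u, v⟫_ℝ := by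
    have hderiv := hasFDerivAt_adjoint hdiff.hasFDerivAt
    simp only [hR] at hderiv
    have hself : (fderiv ℝ (P.R k) x h).adjoint = fderiv ℝ (P.R k) x h :=
      congrArg (fun L : RVec n →L[ℝ] RMat m m => L h) (hderiv.unique hdiff.hasFDerivAt)
    rw [← ContinuousLinearMap.adjoint_inner_right, hself, real_inner_comm]
  rw [inner_bA₁ h3 hk, inner_bC h3 hk]
  simp only [hamiltonianHessian, quadraticRate₂, inner_add_right, real_inner_smul_right]
  dsimp only [coeffA, coeffB, coeffQ, coeffS, coeffR, C2Coeff.ofContDiffOn, ContinuousMap.coe_mk]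
  rw [hsymm]
  ring

end PointwiseFormulas

end AQProblem

section EvolutionFamily

theorem exists_isPrimitiveOn_neg_mul {𝔸 : Type*} [NormedRing 𝔸] [NormedAlgebra ℝ 𝔸]
    [CompleteSpace 𝔸] {a b : ℝ} (hab : a ≤ b) {M : ℝ → 𝔸} (hM : IntervalIntegrable M volume a b) :
    ∃ W : ℝ → 𝔸, IsPrimitiveOn W (fun r => -(W r * M r)) a b ∧ W a = 1 := by
  have hMW : IntervalIntegrable (fun r => -(ContinuousLinearMap.mul ℝ 𝔸).flip (M r)) volume a b :=
    (intervalIntegrable_clm_apply hab continuousOn_const hM).neg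
  obtain ⟨W, hW, -⟩ := existsUnique_linear_volterra hab hMW (.const _ 1)
  have hint : IntervalIntegrable (fun r => -(IccExtend hab W r * M r)) volume a b :=
    (intervalIntegrable_bilin (ContinuousLinearMap.mul ℝ 𝔸) hab
      W.continuous.Icc_extend'.continuousOn hM).neg
  refine ⟨IccExtend hab W, .of_eq_add_integral hab (c := 1) hint fun s hs => ?_, ?_⟩
  · rw [IccExtend_of_mem hab _ hs]
    exact hW ⟨s, hs⟩
  · rw [IccExtend_left, hW, intervalIntegral.integral_same, add_zero, ContinuousMap.const_apply]

variable {E : Type*} [NormedAddCommGroup E] [NormedSpace ℝ E] {a b : ℝ} {M : ℝ → E →L[ℝ] E}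
  {Φ : ℝ → ℝ → E →L[ℝ] E} {W : ℝ → E →L[ℝ] E}

/-- `Φ(s, τ)`, `a ≤ τ ≤ s ≤ b`, is the evolution family of the linear equation `Ẋ = M X`: it
solves the equation in `s` and `Φ(τ, τ) = 1`. -/
structure IsEvolutionFamily (M : ℝ → E →L[ℝ] E) (Φ : ℝ → ℝ → E →L[ℝ] E) (a b : ℝ) : Prop where
  isPrimitiveOn : ∀ τ ∈ Icc a b, IsPrimitiveOn (fun s => Φ s τ) (fun r => M r ∘L Φ r τ) τ b
  self : ∀ τ ∈ Icc a b, Φ τ τ = 1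

variable [CompleteSpace E]

namespace IsEvolutionFamily

theorem comp_eq (hΦ : IsEvolutionFamily M Φ a b)
    (hW : IsPrimitiveOn W (fun r => -(W r * M r)) a b) {τ s : ℝ} (hτ : τ ∈ Icc a b)
    (hs : s ∈ Icc τ b) : W s ∘L Φ s τ = W τ := by
  have hprod := (hW.mono (Icc_subset_Icc_left hτ.1) hτ.2).bilin (ContinuousLinearMap.compL ℝ E E E)
    hτ.2 (hΦ.isPrimitiveOn τ hτ)
  have hconst := hprod.eq_add_integral s hs
  have hzero : ∀ r, W r ∘L (M r ∘L Φ r τ) + (-(W r * M r)) ∘L Φ r τ = 0 := fun r => by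
    ext z
    simp
  simp only [ContinuousLinearMap.compL_apply, hzero, intervalIntegral.integral_zero, add_zero,
    hΦ.self τ hτ] at hconst
  exact hconst

variable [FiniteDimensional ℝ E]

theorem comp_eq_one (hΦ : IsEvolutionFamily M Φ a b)
    (hW : IsPrimitiveOn W (fun r => -(W r * M r)) a b) (hWa : W a = 1) {s : ℝ}
    (hs : s ∈ Icc a b) : Φ s a ∘L W s = 1 := by
  have hleft : (W s : E →ₗ[ℝ] E) * (Φ s a : E →ₗ[ℝ] E) = 1 :=
    congrArg (fun L : E →L[ℝ] E => (L : E →ₗ[ℝ] E))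
      ((hΦ.comp_eq hW (left_mem_Icc.2 (hs.1.trans hs.2)) hs).trans hWa)
  ext z
  exact congrArg (fun L : E →ₗ[ℝ] E => L z) (mul_eq_one_comm.1 hleft)

theorem eq_comp (hΦ : IsEvolutionFamily M Φ a b)
    (hW : IsPrimitiveOn W (fun r => -(W r * M r)) a b) (hWa : W a = 1) {τ s : ℝ}
    (hτ : τ ∈ Icc a b) (hs : s ∈ Icc τ b) : Φ s τ = Φ s a ∘L W τ := by
  rw [← hΦ.comp_eq hW hτ hs, ← ContinuousLinearMap.comp_assoc,
    hΦ.comp_eq_one hW hWa ⟨hτ.1.trans hs.1, hs.2⟩]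
  rfl

theorem continuousOn_right (hab : a ≤ b) (hΦ : IsEvolutionFamily M Φ a b)
    (hM : IntervalIntegrable M volume a b) {s : ℝ} (hs : s ∈ Icc a b) :
    ContinuousOn (fun τ => Φ s τ) (Icc a s) := by
  obtain ⟨W, hW, hWa⟩ := exists_isPrimitiveOn_neg_mul hab hM
  exact (continuousOn_const.clm_comp (hW.continuousOn.mono (Icc_subset_Icc_right hs.2))).congr
    fun τ hτ => hΦ.eq_comp hW hWa ⟨hτ.1, hτ.2.trans hs.2⟩ ⟨hτ.2, hs.2⟩

theorem variation_of_constants (hab : a ≤ b) (hΦ : IsEvolutionFamily M Φ a b)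
    (hM : IntervalIntegrable M volume a b) {X g : ℝ → E}
    (hg : IntervalIntegrable g volume a b)
    (hX : IsPrimitiveOn X (fun r => M r (X r) + g r) a b) (hXa : X a = 0) {s : ℝ}
    (hs : s ∈ Icc a b) : X s = ∫ r in a..s, Φ s r (g r) := by
  obtain ⟨W, hW, hWa⟩ := exists_isPrimitiveOn_neg_mul hab hM
  have hWX := (hW.bilin (ContinuousLinearMap.apply ℝ E).flip hab hX).eq_add_integral s hs
  have hWg : IntervalIntegrable (fun r => W r (g r)) volume a s :=
    (intervalIntegrable_clm_apply hab hW.continuousOn hg).mono_set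
      (uIcc_subset_uIcc_left (Icc_subset_uIcc hs))
  have hcancel : ∀ r, W r (M r (X r) + g r) + (-(W r * M r)) (X r) = W r (g r) := fun r => by
    simp
  simp only [ContinuousLinearMap.flip_apply, ContinuousLinearMap.apply_apply, hXa, map_zero,
    zero_add, hcancel] at hWX
  calc X s = (Φ s a ∘L W s) (X s) := by rw [hΦ.comp_eq_one hW hWa hs]; rfl
    _ = Φ s a (∫ r in a..s, W r (g r)) := congrArg (Φ s a) hWX
    _ = ∫ r in a..s, Φ s a (W r (g r)) := ((Φ s a).intervalIntegral_comp_comm hWg).symm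
    _ = ∫ r in a..s, Φ s r (g r) := intervalIntegral.integral_congr fun r hr => by
      rw [uIcc_of_le hs.1] at hr
      rw [hΦ.eq_comp hW hWa ⟨hr.1, hr.2.trans hs.2⟩ ⟨hr.2, hs.2⟩]
      rfl

end IsEvolutionFamily

end EvolutionFamily

section HilbertSchmidt

variable {E V : Type*} {a b : ℝ}

theorem intervalIntegrable_intervalIntegral [NormedAddCommGroup E] [NormedSpace ℝ E] (hab : a ≤ b)
    {f : ℝ × ℝ → E} (hf : ContinuousOn f (Icc a b ×ˢ Icc a b)) :
    IntervalIntegrable (fun r => ∫ r' in a..b, f (r, r')) volume a b := by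
  have hint : IntegrableOn f (Ioc a b ×ˢ Ioc a b) :=
    (hf.integrableOn_compact (isCompact_Icc.prod isCompact_Icc)).mono_set
      (prod_mono Ioc_subset_Icc_self Ioc_subset_Icc_self)
  rw [IntegrableOn, Measure.volume_eq_prod, ← Measure.prod_restrict] at hint
  simp only [intervalIntegral.integral_of_le hab]
  exact (intervalIntegrable_iff_integrableOn_Ioc_of_le hab).2 hint.integral_prod_left

theorem norm_integral_clm_apply_sq_le [NormedAddCommGroup E] [NormedSpace ℝ E]
    [NormedAddCommGroup V] [NormedSpace ℝ V] (hab : a ≤ b) {L : ℝ → V →L[ℝ] E}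
    (hL : ContinuousOn L (Icc a b)) {v : ℝ → V} (hv : MemLp v 2 (volume.restrict (Ioc a b))) :
    ‖∫ r in a..b, L r (v r)‖ ^ 2 ≤ (∫ r in a..b, ‖L r‖ ^ 2) * ∫ r in a..b, ‖v r‖ ^ 2 := by
  have hmul := integral_mul_norm_le_Lp_mul_Lq (f := fun r => ‖L r‖) (g := fun r => ‖v r‖)
    Real.HolderConjugate.two_two
    (by simpa using (memLp_Ioc_of_continuousOn hL 2).norm) (by simpa using hv.norm)
  simp only [norm_norm, Real.rpow_two, ← Real.sqrt_eq_rpow] at hmul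
  have hLv : Integrable (fun r => ‖L r‖ * ‖v r‖) (volume.restrict (Ioc a b)) :=
    (memLp_Ioc_of_continuousOn hL 2).norm.integrable_mul hv.norm
  have hnorm : ‖∫ r in Ioc a b, L r (v r)‖ ≤ ∫ r in Ioc a b, ‖L r‖ * ‖v r‖ :=
    norm_integral_le_of_norm_le hLv (.of_forall fun r => (L r).le_opNorm (v r))
  simp only [intervalIntegral.integral_of_le hab]
  rw [← Real.sqrt_mul (integral_nonneg fun r => sq_nonneg ‖L r‖)] at hmul
  exact (Real.le_sqrt (norm_nonneg _) (by positivity)).1 (hnorm.trans hmul)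

variable [NormedAddCommGroup E] [InnerProductSpace ℝ E] [CompleteSpace E] [NormedAddCommGroup V]
  [InnerProductSpace ℝ V] [CompleteSpace V]

theorem sq_inner_integral_clm_apply_le (hab : a ≤ b) {K : ℝ → V →L[ℝ] E}
    (hK : ContinuousOn K (Icc a b)) {v : ℝ → V} (hv : MemLp v 2 (volume.restrict (Ioc a b)))
    (w : E) :
    ⟪w, ∫ r in a..b, K r (v r)⟫_ℝ ^ 2 ≤
      (∫ r in a..b, ‖(K r).adjoint w‖ ^ 2) * ∫ r in a..b, ‖v r‖ ^ 2 := by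
  have hKv : IntervalIntegrable (fun r => K r (v r)) volume a b :=
    intervalIntegrable_clm_apply hab hK
      ((intervalIntegrable_iff_integrableOn_Ioc_of_le hab).2 (hv.integrable one_le_two))
  have hKw : ContinuousOn (fun r => innerSL ℝ ((K r).adjoint w)) (Icc a b) :=
    (innerSL ℝ).continuous.comp_continuousOn
      ((ContinuousLinearMap.adjoint.continuous.comp_continuousOn hK).clm_apply continuousOn_const)
  have hinner : ⟪w, ∫ r in a..b, K r (v r)⟫_ℝ =
      ∫ r in a..b, innerSL ℝ ((K r).adjoint w) (v r) := by
    simp only [innerSL_apply_apply, ContinuousLinearMap.adjoint_inner_left]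
    exact ((innerSL ℝ w).intervalIntegral_comp_comm hKv).symm
  rw [hinner, ← sq_abs, ← Real.norm_eq_abs]
  simpa only [innerSL_apply_norm] using norm_integral_clm_apply_sq_le hab hKw hv

theorem inner_integral_le_hilbertSchmidt (hab : a ≤ b) (N : E →L[ℝ] E) {K : ℝ → V →L[ℝ] E}
    (hK : ContinuousOn K (Icc a b)) {v : ℝ → V} (hv : MemLp v 2 (volume.restrict (Ioc a b))) :
    ⟪N (∫ r in a..b, K r (v r)), ∫ r in a..b, K r (v r)⟫_ℝ ≤
      √(∫ r in a..b, ∫ r' in a..b, ‖(K r).adjoint ∘L N ∘L K r'‖ ^ 2) *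
        ∫ r in a..b, ‖v r‖ ^ 2 := by
  set p := ∫ r in a..b, K r (v r) with hp
  set c := ∫ r in a..b, ‖v r‖ ^ 2
  have hc : 0 ≤ c := intervalIntegral.integral_nonneg hab fun r _ => sq_nonneg _
  have hKv : IntervalIntegrable (fun r => K r (v r)) volume a b :=
    intervalIntegrable_clm_apply hab hK
      ((intervalIntegrable_iff_integrableOn_Ioc_of_le hab).2 (hv.integrable one_le_two))
  have hKadj : ContinuousOn (fun r => (K r).adjoint) (Icc a b) :=
    ContinuousLinearMap.adjoint.continuous.comp_continuousOn hK
  have hkernel : ContinuousOn (fun q : ℝ × ℝ => ‖(K q.1).adjoint ∘L N ∘L K q.2‖ ^ 2)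
      (Icc a b ×ˢ Icc a b) :=
    ((hKadj.comp continuousOn_fst fun q hq => hq.1).clm_comp (continuousOn_const.clm_comp
      (hK.comp continuousOn_snd fun q hq => hq.2))).norm.pow 2
  have hrow : ∀ r, ‖(K r).adjoint (N p)‖ ^ 2 ≤
      (∫ r' in a..b, ‖(K r).adjoint ∘L N ∘L K r'‖ ^ 2) * c := fun r => by
    rw [hp, ← ContinuousLinearMap.comp_apply,
      ← ContinuousLinearMap.intervalIntegral_comp_comm _ hKv]
    exact norm_integral_clm_apply_sq_le hab (continuousOn_const.clm_comp
      (continuousOn_const.clm_comp hK)) hv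
  have hsq : ⟪N p, p⟫_ℝ ^ 2 ≤
      (∫ r in a..b, ∫ r' in a..b, ‖(K r).adjoint ∘L N ∘L K r'‖ ^ 2) * c * c := by
    refine (sq_inner_integral_clm_apply_le hab hK hv (N p)).trans
      (mul_le_mul_of_nonneg_right ?_ hc)
    rw [← intervalIntegral.integral_mul_const]
    exact intervalIntegral.integral_mono hab
      (uIcc_of_le hab ▸ (hKadj.clm_apply continuousOn_const).norm.pow 2).intervalIntegrable
      ((intervalIntegrable_intervalIntegral hab hkernel).mul_const c) hrow
  refine (Real.le_sqrt_of_sq_le hsq).trans_eq ?_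
  rw [mul_assoc, Real.sqrt_mul' _ (mul_self_nonneg c), Real.sqrt_mul_self hc]

end HilbertSchmidt

section CompletionOfSquares

variable {V E : Type*} [NormedAddCommGroup V] [InnerProductSpace ℝ V] {ρ : ℝ} {R : V →L[ℝ] V}

theorem mul_norm_sq_le_inner_of_smul_one_le {β c δ : ℝ}
    (h : δ • (1 : V →L[ℝ] V) ≤ β • R - c • (1 : V →L[ℝ] V)) (x : V) :
    (δ + c) * ‖x‖ ^ 2 ≤ β * ⟪R x, x⟫_ℝ := by
  have hx := ((ContinuousLinearMap.le_def _ _).1 h).inner_nonneg_left x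
  simp only [sub_apply, smul_apply, one_apply_eq_self, inner_sub_left, real_inner_smul_left,
    real_inner_self_eq_norm_sq] at hx
  linarith

variable [FiniteDimensional ℝ V]

theorem isInvertible_of_mul_norm_sq_le_inner (hρ : 0 < ρ)
    (hR : ∀ x, ρ * ‖x‖ ^ 2 ≤ ⟪R x, x⟫_ℝ) : R.IsInvertible := by
  have hinj : Function.Injective (R : V →ₗ[ℝ] V) := by
    refine (injective_iff_map_eq_zero _).2 fun x hx => ?_
    have hle := hR x
    rw [show R x = 0 from hx, inner_zero_left] at hle
    by_contra hne
    exact hle.not_gt (mul_pos hρ (pow_pos (norm_pos_iff.2 hne) 2))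
  exact ⟨(LinearEquiv.ofInjectiveEndo _ hinj).toContinuousLinearEquiv, by ext; rfl⟩

variable [NormedAddCommGroup E] [InnerProductSpace ℝ E] [CompleteSpace E]

theorem inner_quadratic_form_ge {α : ℝ} (hρ : 0 < ρ) (hα : 0 < α)
    (hR : ∀ x, ρ * ‖x‖ ^ 2 ≤ ⟪R x, x⟫_ℝ) (hR_symm : R.adjoint = R) {A₁ Q : E →L[ℝ] E}
    {C : E →L[ℝ] V} (h : 0 ≤ A₁ + Q - α⁻¹ • (C.adjoint ∘L R.inverse ∘L C)) (x : E) (v : V) :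
    (1 - α) * ⟪R v, v⟫_ℝ - ⟪Q x, x⟫_ℝ ≤ ⟪R v, v⟫_ℝ + ⟪A₁ x, x⟫_ℝ + 2 * ⟪C x, v⟫_ℝ := by
  have hschur := ((ContinuousLinearMap.nonneg_iff_isPositive _).1 h).inner_nonneg_left x
  simp only [sub_apply, add_apply, smul_apply, ContinuousLinearMap.comp_apply, inner_sub_left,
    inner_add_left, real_inner_smul_left, ContinuousLinearMap.adjoint_inner_left] at hschur
  set w := R.inverse (C x)
  have hRw : R w = C x := (isInvertible_of_mul_norm_sq_le_inner hρ hR).self_apply_inverse (C x)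
  have hRvw : ⟪R v, w⟫_ℝ = ⟪C x, v⟫_ℝ := by
    rw [← hR_symm, ContinuousLinearMap.adjoint_inner_left, hRw, real_inner_comm]
  have hpos : 0 ≤ ⟪R (v + α⁻¹ • w), v + α⁻¹ • w⟫_ℝ :=
    (mul_nonneg hρ.le (sq_nonneg _)).trans (hR _)
  have hsquare : α * ⟪R (v + α⁻¹ • w), v + α⁻¹ • w⟫_ℝ
      = α * ⟪R v, v⟫_ℝ + 2 * ⟪C x, v⟫_ℝ + α⁻¹ * ⟪w, C x⟫_ℝ := by
    rw [map_add, map_smul, hRw, inner_add_left, inner_add_right, inner_add_right,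
      real_inner_smul_left, real_inner_smul_left, real_inner_smul_right, real_inner_smul_right,
      hRvw, real_inner_comm (C x) w]
    field_simp
    ring
  linarith [mul_nonneg hα.le hpos]

end CompletionOfSquares

theorem intervalIntegrable_inner_clm_apply {V W : Type*} [NormedAddCommGroup V] [NormedSpace ℝ V]
    [NormedAddCommGroup W] [InnerProductSpace ℝ W] {a b : ℝ} (hab : a ≤ b) {L : ℝ → V →L[ℝ] W}
    (hL : ContinuousOn L (Icc a b)) (u : L2Ioc V a b) (v : L2Ioc W a b) :
    IntervalIntegrable (fun r => ⟪L r (u r), v r⟫_ℝ) volume a b := by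
  let L' : C(Icc a b, V →L[ℝ] W) := ⟨fun s => L s, hL.domRestrict⟩
  refine (L2Ioc.inner_eq_integral hab ((coeFn_applyL2 hab L' u).trans ?_) (.refl _ v)).1
  filter_upwards [ae_restrict_mem measurableSet_Ioc] with r hr
  rw [IccExtend_of_mem hab _ (Ioc_subset_Icc_self hr)]
  rfl

theorem integrable_of_forall_integrable_inner {n : ℕ} {α : Type*} [MeasurableSpace α]
    {μ : Measure α} {f : α → RVec n} (hf : ∀ w, Integrable (fun r => ⟪f r, w⟫_ℝ) μ) :
    Integrable f μ :=
  Integrable.of_eval_piLp fun i => by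
    simpa [EuclideanSpace.inner_single_right] using hf (EuclideanSpace.single i 1)

namespace AQProblem

variable {n m : ℕ} {P : AQProblem n m} {t : ℝ} {X Y : ℝ → RVec n} {u : ControlSpace m t P.T}

section Trajectory

theorem continuousOn_comp_trajectory {W : Type*} [TopologicalSpace W] {f : ℝ × RVec n → W}
    (hf : ContinuousOn f P.domain) (ht : 0 ≤ t) (hX : ContinuousOn X (Icc t P.T)) :
    ContinuousOn (fun s => f (s, X s)) (Icc t P.T) :=
  hf.comp (continuousOn_id.prodMk hX) fun _ hs => ⟨⟨ht.trans hs.1, hs.2⟩, mem_univ _⟩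

theorem continuousOn_fderiv_trajectory {V : Type*} [NormedAddCommGroup V] [NormedSpace ℝ V]
    (hT : 0 < P.T) {f : ℝ → RVec n → V}
    (hf : ContDiffOn ℝ 2 (fun p : ℝ × RVec n => f p.1 p.2) P.domain)
    (ht : 0 ≤ t) (hX : ContinuousOn X (Icc t P.T)) :
    ContinuousOn (fun s => fderiv ℝ (f s) (X s)) (Icc t P.T) :=
  continuousOn_comp_trajectory (contDiffOn_fderiv_prod (k := 1) hT hf).continuousOn ht hX

theorem intervalIntegrable_bA (hT : 0 < P.T) (h3 : P.H3) (ht : t ∈ Icc 0 P.T)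
    (hX : ContinuousOn X (Icc t P.T)) :
    IntervalIntegrable (fun s => P.bA s (X s) (u s)) volume t P.T := by
  have hA := continuousOn_fderiv_trajectory hT h3.smooth_A ht.1 hX
  have hB := (ContinuousLinearMap.flipₗᵢ ℝ (RVec n) (RVec m) (RVec n)).continuous.comp_continuousOn
    (continuousOn_fderiv_trajectory hT h3.smooth_B ht.1 hX)
  refine ((uIcc_of_le ht.2 ▸ hA).intervalIntegrable.add
    (intervalIntegrable_clm_apply ht.2 hB (L2Ioc.intervalIntegrable ht.2 u))).congr fun s hs => ?_
  rw [uIoc_of_le ht.2] at hs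
  ext1 h
  rw [bA_apply h3 ⟨ht.1.trans hs.1.le, hs.2⟩]
  rfl

theorem IsFundamentalMatrix.isEvolutionFamily {M : ℝ → RMat n n} {Φ : ℝ → ℝ → RMat n n}
    (hΦ : P.IsFundamentalMatrix t M Φ) (hM : IntervalIntegrable M volume t P.T) :
    IsEvolutionFamily M Φ t P.T where
  isPrimitiveOn τ hτ := by
    have hMτ : IntervalIntegrable M volume τ P.T :=
      hM.mono_set (uIcc_subset_uIcc_right (Icc_subset_uIcc hτ))
    refine .of_eq_add_integral hτ.2 ?_ (hΦ τ hτ).2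
    exact intervalIntegrable_bilin (ContinuousLinearMap.compL ℝ (RVec n) (RVec n) (RVec n)).flip
      hτ.2 (hΦ τ hτ).1 hMτ
  self τ hτ := by
    rw [(hΦ τ hτ).2 τ (left_mem_Icc.2 hτ.2), intervalIntegral.integral_same, add_zero]

variable (hT : 0 < P.T) (h3 : P.H3) (ht : t ∈ Icc 0 P.T) (hX : ContinuousOn X (Icc t P.T))

include hT h3 ht hX

theorem intervalIntegrable_hamiltonian_derivative (hY : ContinuousOn Y (Icc t P.T)) (h : RVec n) :
    IntervalIntegrable (fun r => ⟪Y r, fderiv ℝ (P.A r) (X r) h + fderiv ℝ (P.B r) (X r) h (u r)⟫_ℝ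
      + fderiv ℝ (P.Q r) (X r) h + ⟪fderiv ℝ (P.S r) (X r) h, u r⟫_ℝ
      + 1 / 2 * ⟪fderiv ℝ (P.R r) (X r) h (u r), u r⟫_ℝ) volume t P.T := by
  have hA := (continuousOn_fderiv_trajectory hT h3.smooth_A ht.1 hX).clm_apply
    (continuousOn_const (c := h))
  have hB := (continuousOn_fderiv_trajectory hT h3.smooth_B ht.1 hX).clm_apply
    (continuousOn_const (c := h))
  have hQ := (continuousOn_fderiv_trajectory hT h3.smooth_Q ht.1 hX).clm_apply
    (continuousOn_const (c := h))
  have hS := (continuousOn_fderiv_trajectory hT h3.smooth_S ht.1 hX).clm_apply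
    (continuousOn_const (c := h))
  have hR := (continuousOn_fderiv_trajectory hT h3.smooth_R ht.1 hX).clm_apply
    (continuousOn_const (c := h))
  have hu := L2Ioc.intervalIntegrable ht.2 u
  exact (((intervalIntegrable_bilin (innerSL ℝ) ht.2 hY
    ((uIcc_of_le ht.2 ▸ hA).intervalIntegrable.add (intervalIntegrable_clm_apply ht.2 hB hu))).add
    (uIcc_of_le ht.2 ▸ hQ).intervalIntegrable).add
    (intervalIntegrable_bilin (innerSL ℝ) ht.2 hS hu)).add
    ((intervalIntegrable_inner_clm_apply ht.2 hR u u).const_mul _)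

theorem IsAdjointState.isPrimitiveOn (hY : P.IsAdjointState t u X Y) :
    IsPrimitiveOn Y (fun r => -((P.bA r (X r) (u r)).adjoint (Y r) + gradient (P.Q r) (X r)
        + (fderiv ℝ (P.S r) (X r)).adjoint (u r)
        + (1 / 2 : ℝ) • gradient (fun z => ⟪P.R r z (u r), u r⟫_ℝ) (X r))) t P.T := by
  refine .of_eq_add_integral_right ht.2 ?_ hY.2
  refine (intervalIntegrable_iff_integrableOn_Ioc_of_le ht.2).2
    (integrable_of_forall_integrable_inner fun h => ?_)
  refine ((intervalIntegrable_iff_integrableOn_Ioc_of_le ht.2).1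
    (intervalIntegrable_hamiltonian_derivative hT h3 ht hX hY.1 (u := u) h)).congr_fun
    (fun r hr => ?_) measurableSet_Ioc
  exact (inner_adjointRate hT h3 ht ⟨r, Ioc_subset_Icc_self hr⟩ (X r) (Y r) (u r) h).symm

theorem intervalIntegrable_inner_bC (hY : ContinuousOn Y (Icc t P.T)) {X₁ : ℝ → RVec n}
    (hX₁ : ContinuousOn X₁ (Icc t P.T)) (v : ControlSpace m t P.T) :
    IntervalIntegrable (fun s => ⟪P.bC s (X s) (Y s) (u s) (X₁ s), v s⟫_ℝ) volume t P.T := by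
  have hB := (continuousOn_fderiv_trajectory hT h3.smooth_B ht.1 hX).clm_apply hX₁
  have hS := (continuousOn_fderiv_trajectory hT h3.smooth_S ht.1 hX).clm_apply hX₁
  have hR := (continuousOn_fderiv_trajectory hT h3.smooth_R ht.1 hX).clm_apply hX₁
  have hv := L2Ioc.intervalIntegrable ht.2 v
  refine (((intervalIntegrable_inner_clm_apply ht.2 hR u v).add
    (intervalIntegrable_bilin (innerSL ℝ) ht.2 hS hv)).add
    (intervalIntegrable_bilin (innerSL ℝ) ht.2 hY
      (intervalIntegrable_clm_apply ht.2 hB hv))).congr fun s hs => ?_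
  rw [uIoc_of_le ht.2] at hs
  exact (inner_bC h3 ⟨ht.1.trans hs.1.le, hs.2⟩ (X s) (Y s) (u s) (X₁ s) (v s)).symm

theorem IsFundamentalMatrix.eq_linResponse {Φ : ℝ → ℝ → RMat n n}
    (hΦ : P.IsFundamentalMatrix t (fun s => P.bA s (X s) (u s)) Φ) {v : ControlSpace m t P.T}
    {Z X₁ : C(Icc t P.T, RVec n)} (hXZ : ∀ s : Icc t P.T, X s = Z s)
    (hX₁ : X₁ = primitive ht.2 (affineRate ht.2 ((coeffA hT h3 ht).jet₁ Z X₁)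
        ((coeffB hT h3 ht).jet₁ Z X₁) u + applyL2 ht.2 (superpose (coeffB hT h3 ht).f₀ Z) v))
    (s : Icc t P.T) :
    X₁ s = P.linResponse t X Φ v s := by
  have hM := intervalIntegrable_bA hT h3 ht hX (u := u)
  have hB := continuousOn_comp_trajectory h3.smooth_B.continuousOn ht.1 hX
  have hprim := isPrimitiveOn_primitive ht.2 (φ := fun r =>
    P.bA r (X r) (u r) (IccExtend ht.2 X₁ r) + P.B r (X r) (v r)) <|
    ((Lp.coeFn_add _ _).trans ((coeFn_affineRate ht.2 ((coeffA hT h3 ht).jet₁ Z X₁)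
      ((coeffB hT h3 ht).jet₁ Z X₁) u).add
      (coeFn_applyL2 ht.2 (superpose (coeffB hT h3 ht).f₀ Z) v))).trans <| by
    filter_upwards [ae_restrict_mem measurableSet_Ioc] with r hr
    have hr' := Ioc_subset_Icc_self hr
    simp only [Pi.add_apply, IccExtend_of_mem ht.2 _ hr', bA_apply h3 ⟨ht.1.trans hr'.1, hr'.2⟩,
      hXZ ⟨r, hr'⟩]
    rfl
  rw [← hX₁] at hprim
  have hzero : IccExtend ht.2 X₁ t = 0 := by
    rw [IccExtend_left, hX₁, primitive_apply, intervalIntegral.integral_same]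
  have h := (hΦ.isEvolutionFamily hM).variation_of_constants ht.2 hM
    (intervalIntegrable_clm_apply ht.2 hB (L2Ioc.intervalIntegrable ht.2 v)) hprim hzero s.2
  rwa [IccExtend_of_mem ht.2 _ s.2] at h

end Trajectory

end AQProblem

namespace AQProblem

variable {n m : ℕ} {P : AQProblem n m} {t : ℝ}

section SecondDerivative

variable {hT : 0 < P.T} {h3 : P.H3} {ht : t ∈ Icc 0 P.T}
  (hA : (coeffA hT h3 ht).UniformlyLipschitz) (hB : (coeffB hT h3 ht).UniformlyLipschitz)
  (hR : ∀ s ∈ Icc 0 P.T, ∀ x : RVec n, (P.R s x).adjoint = P.R s x)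
  {x : RVec n} {u : ControlSpace m t P.T} {X Y : ℝ → RVec n}
  (hX : P.IsState t x u X) (hY : P.IsAdjointState t u X Y) {Φ : ℝ → ℝ → RMat n n}
  (hΦ : P.IsFundamentalMatrix t (fun s => P.bA s (X s) (u s)) Φ) (v : ControlSpace m t P.T)

include hA hB hR hX hY hΦ

theorem fderiv_fderiv_J_eq_integral_add :
    ContinuousOn (P.linResponse t X Φ v) (Icc t P.T) ∧
    IntervalIntegrable (fun s => ⟪P.R s (X s) (v s), v s⟫_ℝ
      + ⟪P.bA₁ s (X s) (Y s) (u s) (P.linResponse t X Φ v s), P.linResponse t X Φ v s⟫_ℝ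
      + 2 * ⟪P.bC s (X s) (Y s) (u s) (P.linResponse t X Φ v s), v s⟫_ℝ) volume t P.T ∧
    fderiv ℝ (fderiv ℝ (P.J t x)) u v v =
      ⟪hessian P.G (X P.T) (P.linResponse t X Φ v P.T), P.linResponse t X Φ v P.T⟫_ℝ
      + ∫ s in t..P.T, (⟪P.R s (X s) (v s), v s⟫_ℝ
        + ⟪P.bA₁ s (X s) (Y s) (u s) (P.linResponse t X Φ v s), P.linResponse t X Φ v s⟫_ℝ
        + 2 * ⟪P.bC s (X s) (Y s) (u s) (P.linResponse t X Φ v s), v s⟫_ℝ) := by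
  have hT' := right_mem_Icc.2 ht.2
  have hXZ := fun s : Icc t P.T => hX.eq_stateMap hA hB s.2
  obtain ⟨X₁, hX₁, hint, hJ⟩ := exists_fderiv_fderiv_bolzaCost ht.2 (coeffQ hT h3 ht)
    (coeffS hT h3 ht) (coeffR hT h3 ht) h3.smooth_G hA hB x u v rfl
    (hY.isPrimitiveOn hT h3 ht hX.1)
    (fun h => by
      rw [hY.2 P.T hT', intervalIntegral.integral_same, add_zero, inner_gradient_left,
        hXZ ⟨P.T, hT'⟩])
    (fun r hr h => by
      rw [← hXZ ⟨r, hr⟩]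
      exact inner_adjointRate hT h3 ht ⟨r, hr⟩ (X r) (Y r) (u r) h)
  have hlin := hΦ.eq_linResponse hT h3 ht hX.1 hXZ hX₁
  have hrate : ∀ r ∈ Icc t P.T, hamiltonianHessian (coeffQ hT h3 ht) (coeffS hT h3 ht)
      (coeffR hT h3 ht) (coeffA hT h3 ht) (coeffB hT h3 ht) (projIcc t P.T ht.2 r)
      (stateMap ht.2 hA hB x u (projIcc t P.T ht.2 r)) (Y r) (u r)
      (X₁ (projIcc t P.T ht.2 r)) (v r) = ⟪P.R r (X r) (v r), v r⟫_ℝ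
      + ⟪P.bA₁ r (X r) (Y r) (u r) (P.linResponse t X Φ v r), P.linResponse t X Φ v r⟫_ℝ
      + 2 * ⟪P.bC r (X r) (Y r) (u r) (P.linResponse t X Φ v r), v r⟫_ℝ := fun r hr => by
    rw [projIcc_of_mem ht.2 hr, hamiltonianHessian_coeff hT h3 ht ⟨r, hr⟩
      (hR r ⟨ht.1.trans hr.1, hr.2⟩), ← hXZ ⟨r, hr⟩, hlin ⟨r, hr⟩]
  refine ⟨continuousOn_iff_continuous_domRestrict.2 (X₁.continuous.congr hlin),
    hint.congr fun r hr => hrate r (Ioc_subset_Icc_self (uIoc_of_le ht.2 ▸ hr)), ?_⟩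
  rw [J_eq_bolzaCost hA hB x, hJ,
    intervalIntegral.integral_congr fun r hr => hrate r (uIcc_of_le ht.2 ▸ hr), hlin ⟨P.T, hT'⟩,
    ← hXZ ⟨P.T, hT'⟩, ← inner_fderiv_gradient h3.smooth_G, hessian]

theorem fderiv_fderiv_J_eq :
    IntervalIntegrable (fun s => ⟪P.R s (X s) (v s), v s⟫_ℝ) volume t P.T ∧
    IntervalIntegrable (fun s => ⟪P.bA₁ s (X s) (Y s) (u s) (P.linResponse t X Φ v s),
      P.linResponse t X Φ v s⟫_ℝ) volume t P.T ∧
    IntervalIntegrable (fun s => ⟪P.bC s (X s) (Y s) (u s) (P.linResponse t X Φ v s), v s⟫_ℝ)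
      volume t P.T ∧
    fderiv ℝ (fderiv ℝ (P.J t x)) u v v =
      (∫ s in t..P.T, ⟪P.R s (X s) (v s), v s⟫_ℝ)
      + ⟪hessian P.G (X P.T) (P.linResponse t X Φ v P.T), P.linResponse t X Φ v P.T⟫_ℝ
      + (∫ s in t..P.T, ⟪P.bA₁ s (X s) (Y s) (u s) (P.linResponse t X Φ v s),
          P.linResponse t X Φ v s⟫_ℝ)
      + 2 * ∫ s in t..P.T, ⟪P.bC s (X s) (Y s) (u s) (P.linResponse t X Φ v s), v s⟫_ℝ := by
  obtain ⟨hlin, hint, hJ⟩ := fderiv_fderiv_J_eq_integral_add hA hB hR hX hY hΦ v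
  have iR := intervalIntegrable_inner_clm_apply ht.2
    (continuousOn_comp_trajectory h3.smooth_R.continuousOn ht.1 hX.1) v v
  have iC := intervalIntegrable_inner_bC hT h3 ht hX.1 hY.1 hlin v (u := u)
  have iA : IntervalIntegrable (fun s => ⟪P.bA₁ s (X s) (Y s) (u s) (P.linResponse t X Φ v s),
      P.linResponse t X Φ v s⟫_ℝ) volume t P.T :=
    ((hint.sub iR).sub (iC.const_mul 2)).congr fun r _ => by ring
  refine ⟨iR, iA, iC, ?_⟩
  rw [hJ, intervalIntegral.integral_add (iR.add iA) (iC.const_mul 2),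
    intervalIntegral.integral_add iR iA, intervalIntegral.integral_const_mul]
  ring

end SecondDerivative

end AQProblem

theorem integral_mul_integral_left_eq_integral_right_mul {a b : ℝ} (hab : a ≤ b) {k w : ℝ → ℝ}
    (hk : IntervalIntegrable k volume a b) (hw : IntervalIntegrable w volume a b) :
    IntervalIntegrable (fun s => k s * ∫ r in a..s, w r) volume a b ∧
    IntervalIntegrable (fun s => (∫ τ in s..b, k τ) * w s) volume a b ∧
    ∫ s in a..b, k s * ∫ r in a..s, w r = ∫ s in a..b, (∫ τ in s..b, k τ) * w s := by
  have hK : IsPrimitiveOn (fun s => ∫ τ in s..b, k τ) (fun r => -k r) a b :=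
    .of_eq_add_integral_right hab (c := 0) hk fun s _ => (zero_add _).symm
  have hW : IsPrimitiveOn (fun s => ∫ r in a..s, w r) w a b :=
    .of_eq_add_integral hab (c := 0) hw fun s _ => (zero_add _).symm
  have hkW := hk.mul_continuousOn (uIcc_of_le hab ▸ hW.continuousOn)
  have hKw := hw.continuousOn_mul (uIcc_of_le hab ▸ hK.continuousOn)
  refine ⟨hkW, hKw, ?_⟩
  have hprod := (hK.bilin (ContinuousLinearMap.mul ℝ ℝ) hab hW).eq_add_integral b
    (right_mem_Icc.2 hab)
  simp only [ContinuousLinearMap.mul_apply', intervalIntegral.integral_same, zero_mul, mul_zero,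
    zero_add, neg_mul, ← sub_eq_add_neg] at hprod
  rw [intervalIntegral.integral_sub hKw hkW] at hprod
  linarith

namespace AQProblem

variable {n m : ℕ} {P : AQProblem n m} {t : ℝ}

theorem kernelNorm_nonneg (X : ℝ → RVec n) (Φ : ℝ → ℝ → RMat n n) (M : RMat n n) (τ : ℝ) :
    0 ≤ P.kernelNorm t X Φ M τ :=
  Real.sqrt_nonneg _

theorem QHat_nonneg (X : ℝ → RVec n) (Φ : ℝ → ℝ → RMat n n) (Qbar : ℝ → RMat n n) {s : ℝ}
    (hs : s ≤ P.T) : 0 ≤ P.QHat t X Φ Qbar s :=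
  intervalIntegral.integral_nonneg hs fun τ _ => kernelNorm_nonneg X Φ (Qbar τ) τ

section UniformPositivity

variable {u : ControlSpace m t P.T} {X Y : ℝ → RVec n} {Φ : ℝ → ℝ → RMat n n}

theorem inner_linResponse_le (hT : 0 < P.T) (h3 : P.H3) (ht : t ∈ Icc 0 P.T)
    (hX : ContinuousOn X (Icc t P.T))
    (hΦ : P.IsFundamentalMatrix t (fun s => P.bA s (X s) (u s)) Φ) (M : RMat n n)
    (v : ControlSpace m t P.T) {τ : ℝ} (hτ : τ ∈ Icc t P.T) :
    ⟪M (P.linResponse t X Φ v τ), P.linResponse t X Φ v τ⟫_ℝ ≤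
      P.kernelNorm t X Φ M τ * ∫ r in t..τ, ‖v r‖ ^ 2 := by
  have hM := intervalIntegrable_bA hT h3 ht hX (u := u)
  have hK : ContinuousOn (fun r => Φ τ r ∘L P.B r (X r)) (Icc t τ) :=
    ((hΦ.isEvolutionFamily hM).continuousOn_right ht.2 hM hτ).clm_comp
      ((continuousOn_comp_trajectory h3.smooth_B.continuousOn ht.1 hX).mono
        (Icc_subset_Icc_right hτ.2))
  have hv : MemLp v 2 (volume.restrict (Ioc t τ)) :=
    (Lp.memLp v).mono_measure (Measure.restrict_mono (Ioc_subset_Ioc_right hτ.2) le_rfl)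
  have hle := inner_integral_le_hilbertSchmidt hτ.1 M hK hv
  simp only [ContinuousLinearMap.adjoint_comp] at hle
  exact hle

variable {Gbar : RMat n n} {Qbar : ℝ → RMat n n} {α δ : ℝ}

theorem neg_GHat_mul_le_inner_hessian (hT : 0 < P.T) (h3 : P.H3) (ht : t ∈ Icc 0 P.T)
    (hX : ContinuousOn X (Icc t P.T))
    (hΦ : P.IsFundamentalMatrix t (fun s => P.bA s (X s) (u s)) Φ)
    (hG : 0 ≤ hessian P.G (X P.T) + Gbar) (v : ControlSpace m t P.T) :
    -(P.GHat t X Φ Gbar * ∫ r in t..P.T, ‖v r‖ ^ 2) ≤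
      ⟪hessian P.G (X P.T) (P.linResponse t X Φ v P.T), P.linResponse t X Φ v P.T⟫_ℝ := by
  have hnonneg := ((ContinuousLinearMap.nonneg_iff_isPositive _).1 hG).inner_nonneg_left
    (P.linResponse t X Φ v P.T)
  have hle : _ ≤ P.GHat t X Φ Gbar * _ :=
    inner_linResponse_le hT h3 ht hX hΦ Gbar v (right_mem_Icc.2 ht.2)
  rw [add_apply, inner_add_left] at hnonneg
  linarith

theorem running_rate_ge (hT : 0 < P.T) (h3 : P.H3) (ht : t ∈ Icc 0 P.T)
    (hX : ContinuousOn X (Icc t P.T))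
    (hΦ : P.IsFundamentalMatrix t (fun s => P.bA s (X s) (u s)) Φ)
    (v : ControlSpace m t P.T) {s : ℝ} (hs : s ∈ Icc t P.T)
    (hR : (P.R s (X s)).adjoint = P.R s (X s)) (hα : α ∈ Ioo 0 1) (hδ_pos : 0 < δ)
    (hA₁ : 0 ≤ P.bA₁ s (X s) (Y s) (u s) + Qbar s
        - α⁻¹ • ((P.bC s (X s) (Y s) (u s)).adjoint ∘L (P.R s (X s)).inverse ∘L
            P.bC s (X s) (Y s) (u s)))
    (hδ : δ • (1 : RMat m m) ≤
      (1 - α) • P.R s (X s) - (P.GHat t X Φ Gbar + P.QHat t X Φ Qbar s) • (1 : RMat m m)) :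
    (δ + P.GHat t X Φ Gbar) * ‖v s‖ ^ 2 + P.QHat t X Φ Qbar s * ‖v s‖ ^ 2
        - P.kernelNorm t X Φ (Qbar s) s * ∫ r in t..s, ‖v r‖ ^ 2 ≤
      ⟪P.R s (X s) (v s), v s⟫_ℝ
      + ⟪P.bA₁ s (X s) (Y s) (u s) (P.linResponse t X Φ v s), P.linResponse t X Φ v s⟫_ℝ
      + 2 * ⟪P.bC s (X s) (Y s) (u s) (P.linResponse t X Φ v s), v s⟫_ℝ := by
  have hβ : 0 < 1 - α := sub_pos.2 hα.2
  have hle := mul_norm_sq_le_inner_of_smul_one_le hδ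
  have hhat : 0 ≤ P.GHat t X Φ Gbar + P.QHat t X Φ Qbar s :=
    add_nonneg (kernelNorm_nonneg X Φ Gbar P.T) (QHat_nonneg X Φ Qbar hs.2)
  have hcoercive : ∀ w, δ / (1 - α) * ‖w‖ ^ 2 ≤ ⟪P.R s (X s) w, w⟫_ℝ := fun w => by
    rw [div_mul_eq_mul_div, div_le_iff₀' hβ]
    linarith [hle w, mul_nonneg hhat (sq_nonneg ‖w‖)]
  have hquad := inner_quadratic_form_ge (div_pos hδ_pos hβ) hα.1 hcoercive hR hA₁
    (P.linResponse t X Φ v s) (v s)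
  linarith [hle (v s), inner_linResponse_le hT h3 ht hX hΦ (Qbar s) v hs]

theorem mul_integral_norm_sq_le_fderiv_fderiv_J {hT : 0 < P.T} {h3 : P.H3} {ht : t ∈ Icc 0 P.T}
    (hA : (coeffA hT h3 ht).UniformlyLipschitz) (hB : (coeffB hT h3 ht).UniformlyLipschitz)
    (hR : ∀ s ∈ Icc 0 P.T, ∀ x : RVec n, (P.R s x).adjoint = P.R s x)
    {x : RVec n} (hX : P.IsState t x u X) (hY : P.IsAdjointState t u X Y)
    (hΦ : P.IsFundamentalMatrix t (fun s => P.bA s (X s) (u s)) Φ)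
    (hα : α ∈ Ioo 0 1) (hδ_pos : 0 < δ) (hG : 0 ≤ hessian P.G (X P.T) + Gbar)
    (hA₁ : ∀ᵐ s ∂(volume.restrict (Ioc t P.T)),
      0 ≤ P.bA₁ s (X s) (Y s) (u s) + Qbar s
        - α⁻¹ • ((P.bC s (X s) (Y s) (u s)).adjoint ∘L (P.R s (X s)).inverse ∘L
            P.bC s (X s) (Y s) (u s)))
    (hQ : IntervalIntegrable (fun τ => P.kernelNorm t X Φ (Qbar τ) τ) volume t P.T)
    (hδ : ∀ s ∈ Icc t P.T, δ • (1 : RMat m m) ≤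
      (1 - α) • P.R s (X s) - (P.GHat t X Φ Gbar + P.QHat t X Φ Qbar s) • (1 : RMat m m))
    (v : ControlSpace m t P.T) :
    δ * ∫ s in t..P.T, ‖v s‖ ^ 2 ≤ fderiv ℝ (fderiv ℝ (P.J t x)) u v v := by
  obtain ⟨-, hint, hJ⟩ := fderiv_fderiv_J_eq_integral_add hA hB hR hX hY hΦ v
  have hv : IntervalIntegrable (fun s => ‖v s‖ ^ 2) volume t P.T := by
    simpa only [real_inner_self_eq_norm_sq] using
      (L2Ioc.inner_eq_integral ht.2 (.refl _ v) (.refl _ v)).1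
  obtain ⟨hkN, hQv, hparts⟩ := integral_mul_integral_left_eq_integral_right_mul ht.2 hQ hv
  have hrate := intervalIntegral.integral_mono_ae_restrict ht.2
    (((hv.const_mul (δ + P.GHat t X Φ Gbar)).add hQv).sub hkN) hint <| by
    rw [← restrict_Ioc_eq_restrict_Icc]
    filter_upwards [hA₁, ae_restrict_mem measurableSet_Ioc] with s hs hmem
    have hmem' := Ioc_subset_Icc_self hmem
    exact running_rate_ge hT h3 ht hX.1 hΦ v hmem' (hR s ⟨ht.1.trans hmem'.1, hmem'.2⟩ _) hα hδ_pos
      hs (hδ s hmem')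
  rw [intervalIntegral.integral_sub ((hv.const_mul _).add hQv) hkN,
    intervalIntegral.integral_add (hv.const_mul _) hQv, hparts,
    intervalIntegral.integral_const_mul] at hrate
  linarith [neg_GHat_mul_le_inner_hessian hT h3 ht hX.1 hΦ hG v]

end UniformPositivity

end AQProblem

theorem proposition5p2_general {n m : ℕ} (P : AQProblem n m) (hT : 0 < P.T) {LA LB : ℝ}
    (hA : ∀ t ∈ Icc 0 P.T, ∀ x y, ‖P.A t x - P.A t y‖ ≤ LA * ‖x - y‖)
    (hB : ∀ t ∈ Icc 0 P.T, ∀ x y, ‖P.B t x - P.B t y‖ ≤ LB * ‖x - y‖)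
    (hR : ∀ t ∈ Icc 0 P.T, ∀ x, (P.R t x).adjoint = P.R t x) (h3 : P.H3)
    (t : ℝ) (ht : t ∈ Icc 0 P.T) (x : RVec n) (u : ControlSpace m t P.T)
    (X Y : ℝ → RVec n) (hX : P.IsState t x u X) (hY : P.IsAdjointState t u X Y)
    (Φ : ℝ → ℝ → RMat n n)
    (hΦ : P.IsFundamentalMatrix t (fun s => P.bA s (X s) (u s)) Φ) :
    (∀ w, DifferentiableAt ℝ (P.J t x) w) ∧ DifferentiableAt ℝ (P.DuJ t x) u ∧
    (∀ v : ControlSpace m t P.T,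
      IntervalIntegrable (fun s => ⟪P.R s (X s) (v s), v s⟫_ℝ) volume t P.T ∧
      IntervalIntegrable (fun s => ⟪P.bA₁ s (X s) (Y s) (u s) (P.linResponse t X Φ v s),
        P.linResponse t X Φ v s⟫_ℝ) volume t P.T ∧
      IntervalIntegrable (fun s => ⟪P.bC s (X s) (Y s) (u s) (P.linResponse t X Φ v s), v s⟫_ℝ)
        volume t P.T ∧
      ∫ s in t..P.T, ⟪P.DuuJ t x u v s, v s⟫_ℝ =
        (∫ s in t..P.T, ⟪P.R s (X s) (v s), v s⟫_ℝ)
        + ⟪hessian P.G (X P.T) (P.linResponse t X Φ v P.T), P.linResponse t X Φ v P.T⟫_ℝ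
        + (∫ s in t..P.T, ⟪P.bA₁ s (X s) (Y s) (u s) (P.linResponse t X Φ v s),
            P.linResponse t X Φ v s⟫_ℝ)
        + 2 * ∫ s in t..P.T, ⟪P.bC s (X s) (Y s) (u s) (P.linResponse t X Φ v s), v s⟫_ℝ) ∧
    (∀ (Gbar : RMat n n) (Qbar : ℝ → RMat n n) (α δ : ℝ),
      α ∈ Ioo (0 : ℝ) 1 → 0 < δ →
      0 ≤ hessian P.G (X P.T) + Gbar →
      (∀ᵐ s ∂(volume.restrict (Ioc t P.T)),
        0 ≤ P.bA₁ s (X s) (Y s) (u s) + Qbar s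
          - α⁻¹ • ((P.bC s (X s) (Y s) (u s)).adjoint ∘L (P.R s (X s)).inverse ∘L
              P.bC s (X s) (Y s) (u s))) →
      IntervalIntegrable (fun τ => P.kernelNorm t X Φ (Qbar τ) τ) volume t P.T →
      (∀ s ∈ Icc t P.T,
        δ • (1 : RMat m m) ≤
          (1 - α) • P.R s (X s) - (P.GHat t X Φ Gbar + P.QHat t X Φ Qbar s) • (1 : RMat m m)) →
      δ • (1 : ControlSpace m t P.T →L[ℝ] ControlSpace m t P.T) ≤ P.DuuJ t x u) := by
  have hA' : (AQProblem.coeffA hT h3 ht).UniformlyLipschitz :=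
    C2Coeff.uniformlyLipschitz_ofContDiffOn hT h3.smooth_A ht.1 hA
  have hB' : (AQProblem.coeffB hT h3 ht).UniformlyLipschitz :=
    C2Coeff.uniformlyLipschitz_ofContDiffOn hT h3.smooth_B ht.1 hB
  have hJ : ContDiff ℝ 2 (P.J t x) := AQProblem.contDiff_J hA' hB' x
  have hpair (v w : ControlSpace m t P.T) : ⟪v, w⟫_ℝ = ∫ s in t..P.T, ⟪v s, w s⟫_ℝ :=
    (L2Ioc.inner_eq_integral ht.2 (.refl _ v) (.refl _ w)).2
  refine ⟨hJ.differentiable two_ne_zero, (contDiff_gradient hJ).differentiable one_ne_zero u,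
    fun v => ?_, fun Gbar Qbar α δ hα hδ_pos hG hA₁ hQ hδ => ?_⟩
  · obtain ⟨iR, iA, iC, hD⟩ := AQProblem.fderiv_fderiv_J_eq hA' hB' hR hX hY hΦ v
    exact ⟨iR, iA, iC, by rw [← hpair, ← hD]; exact inner_fderiv_gradient hJ u v v⟩
  · refine smul_one_le_fderiv_gradient hJ fun v => ?_
    rw [← real_inner_self_eq_norm_sq, hpair]
    simpa only [real_inner_self_eq_norm_sq] using
      AQProblem.mul_integral_norm_sq_le_fderiv_fderiv_J hA' hB' hR hX hY hΦ hα hδ_pos hG hA₁ hQ hδ v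

end

theorem proposition5p2 {n m : ℕ} (P : AQProblem n m) (hT : 0 < P.T)
    (h1 : P.H1) (h2 : P.H2) (h3 : P.H3)
    (t : ℝ) (ht : t ∈ Set.Icc 0 P.T) (x : RVec n) (u : ControlSpace m t P.T)
    (X Y : ℝ → RVec n) (hX : P.IsState t x u X) (hY : P.IsAdjointState t u X Y)
    (Φ : ℝ → ℝ → RMat n n)
    (hΦ : P.IsFundamentalMatrix t (fun s => P.bA s (X s) (u s)) Φ) :
    -- the second derivative exists
    (∀ w, DifferentiableAt ℝ (P.J t x) w) ∧ DifferentiableAt ℝ (P.DuJ t x) u ∧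
    -- the explicit expression of its quadratic form (all integrals converge)
    (∀ v : ControlSpace m t P.T,
      IntervalIntegrable (fun s => ⟪P.R s (X s) (v s), v s⟫_ℝ) volume t P.T ∧
      IntervalIntegrable (fun s => ⟪P.bA₁ s (X s) (Y s) (u s) (P.linResponse t X Φ v s),
        P.linResponse t X Φ v s⟫_ℝ) volume t P.T ∧
      IntervalIntegrable (fun s => ⟪P.bC s (X s) (Y s) (u s) (P.linResponse t X Φ v s), v s⟫_ℝ)
        volume t P.T ∧
      ∫ s in t..P.T, ⟪P.DuuJ t x u v s, v s⟫_ℝ =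
        (∫ s in t..P.T, ⟪P.R s (X s) (v s), v s⟫_ℝ)
        + ⟪hessian P.G (X P.T) (P.linResponse t X Φ v P.T), P.linResponse t X Φ v P.T⟫_ℝ
        + (∫ s in t..P.T, ⟪P.bA₁ s (X s) (Y s) (u s) (P.linResponse t X Φ v s),
            P.linResponse t X Φ v s⟫_ℝ)
        + 2 * ∫ s in t..P.T, ⟪P.bC s (X s) (Y s) (u s) (P.linResponse t X Φ v s), v s⟫_ℝ) ∧
    -- the sufficient condition for uniform positivity
    (∀ (Gbar : RMat n n) (Qbar : ℝ → RMat n n) (α δ : ℝ),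
      0 ≤ Gbar → (∀ s ∈ Set.Icc 0 P.T, 0 ≤ Qbar s) → α ∈ Set.Ioo (0 : ℝ) 1 → 0 < δ →
      0 ≤ hessian P.G (X P.T) + Gbar →
      (∀ᵐ s ∂(volume.restrict (Set.Ioc t P.T)),
        0 ≤ P.bA₁ s (X s) (Y s) (u s) + Qbar s
          - α⁻¹ • ((P.bC s (X s) (Y s) (u s)).adjoint ∘L (P.R s (X s)).inverse ∘L
              P.bC s (X s) (Y s) (u s))) →
      -- the integral that defines `QHat` converges
      IntervalIntegrable (fun τ => P.kernelNorm t X Φ (Qbar τ) τ) volume t P.T →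
      (∀ s ∈ Set.Icc t P.T,
        δ • (1 : RMat m m) ≤
          (1 - α) • P.R s (X s) - (P.GHat t X Φ Gbar + P.QHat t X Φ Qbar s) • (1 : RMat m m)) →
      δ • (1 : ControlSpace m t P.T →L[ℝ] ControlSpace m t P.T) ≤ P.DuuJ t x u) := by
  obtain ⟨_, _, hA⟩ := h1.lipschitz_A
  obtain ⟨_, _, hB⟩ := h1.lipschitz_B
  obtain ⟨hd₁, hd₂, hform, hpos⟩ :=
    proposition5p2_general P hT hA hB h2.symmetric_R h3 t ht x u X Y hX hY Φ hΦ
  exact ⟨hd₁, hd₂, hform, fun Gbar Qbar α δ _ _ => hpos Gbar Qbar α δ⟩
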